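/- Let $a\ge 15$ be an integer and let $\rho,\rho'$ be the real roots of $x^3-ax^2-(a+3)x-1$ with $a+1<\rho$ and $-2<\rho'<-1$; put $K=\mathbb Q(\rho)$, a totally real cubic field containing $\rho'$ (a simplest cubic field). The signature of $\alpha\in K$ is the tuple of signs of $\sigma(\alpha)$, where $\sigma$ runs over the three embeddings $K\to\mathbb R$. For a signature $\mathfrak s$, an element $\alpha\in\mathbb Z[\rho]$ of signature $\mathfrak s$ is called $\mathfrak s$-indecomposable in $\mathbb Z[\rho]$ if it is not the sum of two elements of $\mathbb Z[\rho]$ of signature $\mathfrak s$. Let $\beta^{(k)}=(\beta_1^{(k)},\beta_2^{(k)},\beta_3^{(k)})$, $k\ge 0$, be the (homogeneous) Jacobi–Perron expansion of $(1,-\rho',\rho'^2)$, that is, $\beta^{(0)}=(1,-\rho',\rho'^2)$ and $$\beta^{(k+1)}=\Big(\beta_2^{(k)}-\Big\lfloor\tfrac{\beta_2^{(k)}}{\beta_1^{(k)}}\Big\rfloor\beta_1^{(k)},\ \beta_3^{(k)}-\Big\lfloor\tfrac{\beta_3^{(k)}}{\beta_1^{(k)}}\Big\rfloor\beta_1^{(k)},\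 \beta_1^{(k)}\Big).$$ Let $(p,q)=(2,3)$ or $(p,q)=(3,2)$, let $k\ge 0$, and let $i,j\ge 0$ be integers such that 1. $1\le i\le \big\lfloor \beta_p^{(k)}/\beta_1^{(k)}\big\rfloor-1$; 2. $\beta_p^{(k)}-i\beta_1^{(k)}-j\beta_q^{(k)}$ has the same signature as $\beta_p^{(k)}-i\beta_1^{(k)}$; 3. for every integer $l$ with $i+1\le l\le \big\lfloor \beta_p^{(k)}/\beta_1^{(k)}\big\rfloor-1$, the element $(l-i)\beta_1^{(k)}-\beta_q^{(k)}$ does not have the same signature as $\beta_p^{(k)}-i\beta_1^{(k)}$. Then $\beta_p^{(k)}-i\beta_1^{(k)}-j\beta_q^{(k)}$ is $\mathfrak s$-indecomposable in $\mathbb Z[\rho]$, where $\mathfrak s$ is its signature. Moreover, the elements obtained in this way represent all indecomposables of $\mathbb Z[\rho]$ up to multiplication by units and conjugation: for every signature $\mathfrak s$ and every $\mathfrak s$-indecomposable $\alpha\in\mathbb Z[\rho]$ there are an element $\gamma$ as above, a unit $\varepsilon\in\mathbb Z[\rho]^\times$ and an automorphism $\sigma$ of $K$ with $\alpha=\varepsilon\,\sigma(\gamma)$.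 -/

import Mathlib

open scoped IntermediateField

/-- The signature of an element `x` of a (totally real) field `K`: the tuple of the signs of `σ x`,
where `σ` runs over all the embeddings of `K` into `ℝ`. -/
noncomputable def signature {K : Type*} [Field K] (x : K) : (K →+* ℝ) → SignType :=
  fun σ => SignType.sign (σ x)

/-- `x` is `s`-indecomposable in the order `O`: it lies in `O`, it has signature `s`, and it is not
the sum of two elements of `O` of signature `s`. -/
def IsIndecomposableOfSign {K : Type*} [Field K] (O : Subalgebra ℤ K)
    (s : (K →+* ℝ) → SignType) (x : K) : Prop :=
  (x ∈ O ∧ signature x = s) ∧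
    ¬ ∃ y z : K, (y ∈ O ∧ signature y = s) ∧ (z ∈ O ∧ signature z = s) ∧ x = y + z

/-- One step of the homogeneous Jacobi--Perron algorithm for a vector of real numbers that lie
in a subfield `K` of `ℝ`:
`(β₁, …, βₙ) ↦ (β₂ - ⌊β₂ / β₁⌋ β₁, …, βₙ - ⌊βₙ / β₁⌋ β₁, β₁)`.
The coordinates are numbered from `0`, so that `β 0` is `β₁`. -/
noncomputable def jpaStep {K : IntermediateField ℚ ℝ} {m : ℕ} (β : Fin (m + 1) → K) :
    Fin (m + 1) → K :=
  Fin.snoc (α := fun _ => K)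
    (fun i : Fin m => β i.succ - (⌊((β i.succ / β 0 : K) : ℝ)⌋ : K) * β 0) (β 0)

/-- The Jacobi--Perron expansion `β⁽⁰⁾, β⁽¹⁾, β⁽²⁾, …` of the vector `β = β⁽⁰⁾`. -/
noncomputable def jpaExpansion {K : IntermediateField ℚ ℝ} {m : ℕ} (β : Fin (m + 1) → K) (k : ℕ) :
    Fin (m + 1) → K :=
  jpaStep^[k] β

/-- `x = p - i b - j q` with natural numbers `i`, `j` such that
* `1 ≤ i ≤ ⌊p / b⌋ - 1`,
* `p - i b - j q` has the same signature as `p - i b`,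
* for all `i + 1 ≤ l ≤ ⌊p / b⌋ - 1`, the signatures of `(l - i) b - q` and `p - i b` differ. -/
def IsGeneralizedSemiconvergent {K : IntermediateField ℚ ℝ} (b p q x : K) : Prop :=
  ∃ i j : ℕ,
    (1 ≤ i ∧ (i : ℤ) ≤ ⌊((p / b : K) : ℝ)⌋ - 1) ∧
    signature (p - (i : K) * b - (j : K) * q) = signature (p - (i : K) * b) ∧
    (∀ l : ℕ, i + 1 ≤ l → (l : ℤ) ≤ ⌊((p / b : K) : ℝ)⌋ - 1 →
      signature (((l : K) - (i : K)) * b - q) ≠ signature (p - (i : K) * b)) ∧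
    x = p - (i : K) * b - (j : K) * q

/-- The root `ρ'` of `x³ - a x² - (a + 3) x - 1` lies in the field generated by the root `ρ`. -/
theorem root_mem_adjoin {a : ℤ} {ρ ρ' : ℝ} (ha : -1 ≤ a)
    (hρ : ρ ^ 3 - a * ρ ^ 2 - (a + 3) * ρ - 1 = 0) (hρ₁ : a + 1 < ρ)
    (hρ' : ρ' ^ 3 - a * ρ' ^ 2 - (a + 3) * ρ' - 1 = 0) (h₁ : ρ' < -1) :
    ρ' ∈ ℚ⟮ρ⟯ := by
  have ha' : (-1 : ℝ) ≤ a := by exact_mod_cast ha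
  have hpos : 0 < ρ := by linarith
  have key : ρ' = -1 - ρ⁻¹ := by
    have h : (ρ' - ρ) * (ρ * ρ' + ρ + 1) * ((1 + ρ) * ρ' + 1) = 0 := by
      linear_combination (ρ * (1 + ρ)) * hρ' - (ρ' * (1 + ρ')) * hρ
    have e1 : ρ' - ρ ≠ 0 := by
      intro h; linarith
    have e3 : (1 + ρ) * ρ' + 1 ≠ 0 := by
      intro h; nlinarith
    have e2 : ρ * ρ' + ρ + 1 = 0 := by
      rcases mul_eq_zero.mp h with h | h
      · exact (mul_eq_zero.mp h).resolve_left e1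
      · exact absurd h e3
    field_simp
    linarith
  rw [key]
  exact sub_mem (neg_mem (one_mem _)) (inv_mem (IntermediateField.mem_adjoin_simple_self ℚ ρ))

/-! The automorphism `τ : g ↦ -1 - 1/g` permutes the roots of the cubic, and `-1`, `g`, `g + 1` are
units realising all signatures (`exists_isAdjoinUnit_totallyPos`). Hence indecomposables need only
be found among totally positive elements, up to units and `τ`.

Up to unit factors, the Jacobi–Perron expansion runs through the nine explicit vectors `jpaState`,
with period seven after two steps. Scaling by a unit changes neither the quotients nor which
signatures agree, so finitely many families of semiconvergents remain.

Indecomposability: for `α = x + y g + z g²`, each of `x + z`, `z`, `y + a z` is a trace `Tr(δ α)`,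
with `δ` of the signature of `1`, `g (g + 1)`, `g + 1` respectively. It is therefore a positive
integer on elements of that signature, and an element where it equals 1 cannot split
(`isIndec_of_functional`). Apart from units, this covers every semiconvergent except one associate
of `1 + g + g²`, which is settled by three conjugate functionals of value 2.

Completeness: induct on the height `x + z` of a totally positive indecomposable. If `y > 0`,
multiplying a conjugate by `g²` lowers the height, unless the element lies in the cone of `1`, `g²`,
`1 + g + g²`; there `1 + g + g²` splits off (`isRepresented_of_pos`). The map `α ↦ g² τ²(α)`
preserves the height and permutes `1`, `g²`, `g²/(g + 1)²`; if `y ≤ 0` along its whole orbit, the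
element lies in the cone of these three units. Unless a unit splits off, it then has three
nonnegative integral coordinates with sum `a (x + z)`. Points of height at least 2 split, and those
of height 1 form a triangle one third of which, up to rotation, is the family of semiconvergents of
state 2 (`isRepresented_of_barycentric`). -/

/-- `g` generates a simplest cubic field with parameter `a`, it is the largest root of
`x³ - a x² - (a + 3) x - 1`, and `τ` is the automorphism `g ↦ -1 - 1 / g`. -/
structure SimplestCubic {K : IntermediateField ℚ ℝ} (a : ℤ) (g : K) (τ : K ≃ₐ[ℚ] K) : Prop where
  le : 15 ≤ a
  root : g ^ 3 = a * g ^ 2 + (a + 3) * g + 1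
  lt : (a : ℝ) + 1 < g
  conj : g * τ g = -(g + 1)

/-- The element `x + y g + z g²`. -/
noncomputable def quadElt {K : IntermediateField ℚ ℝ} (g : K) (x y z : ℤ) : K := x + y * g + z * g ^ 2

/-- All the conjugates of `x` are positive. -/
def TotallyPos {K : IntermediateField ℚ ℝ} (x : K) : Prop := ∀ σ : K →+* ℝ, 0 < σ x

/-- The element `x` is indecomposable for its own signature. -/
def IsIndec {K : IntermediateField ℚ ℝ} (g x : K) : Prop :=
  IsIndecomposableOfSign (Algebra.adjoin ℤ {g}) (signature x) x

/-- `u` is a unit of the ring `ℤ[g]`. -/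
def IsAdjoinUnit {K : IntermediateField ℚ ℝ} (g u : K) : Prop :=
  ∃ ε : (Algebra.adjoin ℤ {g})ˣ, ((ε : Algebra.adjoin ℤ {g}) : K) = u

/-! ### Signatures, total positivity and units of `ℤ[g]`. -/

section basic

variable {K : IntermediateField ℚ ℝ} {a : ℤ} {g : K} {τ : K ≃ₐ[ℚ] K}

theorem signature_eq_iff {x y : K} :
    signature x = signature y ↔ ∀ σ : K →+* ℝ, SignType.sign (σ x) = SignType.sign (σ y) := by
  simp [signature, funext_iff]

theorem signature_mul (x y : K) : signature (x * y) = signature x * signature y := by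
  funext σ; simp [signature, sign_mul]

theorem signature_map_eq (τ : K ≃ₐ[ℚ] K) {x y : K} (h : signature x = signature y) :
    signature (τ x) = signature (τ y) := by
  rw [signature_eq_iff] at h ⊢
  intro σ
  exact h (σ.comp (τ : K →+* K))

theorem signature_mul_eq (u : K) {x y : K} (h : signature x = signature y) :
    signature (u * x) = signature (u * y) := by
  rw [signature_mul, signature_mul, h]

theorem totallyPos_iff_signature {x : K} : TotallyPos x ↔ signature x = signature 1 := by
  rw [signature_eq_iff]
  simp [TotallyPos, sign_eq_one_iff]

/-- A signature is encoded by an element `u` that makes its members totally positive, so every sign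
question becomes one of total positivity. -/
theorem TotallyPos.of_signature_eq {x y u : K} (h : signature x = signature y)
    (hy : TotallyPos (u * y)) : TotallyPos (u * x) := by
  rw [totallyPos_iff_signature] at *
  rw [signature_mul_eq u h, hy]

theorem TotallyPos.signature_eq {x y u : K} (hx : TotallyPos (u * x)) (hy : TotallyPos (u * y)) :
    signature x = signature y := by
  rw [signature_eq_iff]
  intro σ
  have h1 := hx σ
  have h2 := hy σ
  rw [map_mul] at h1 h2
  rcases pos_and_pos_or_neg_and_neg_of_mul_pos h1 with ⟨h3, h4⟩ | ⟨h3, h4⟩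
  · rw [sign_pos h4, sign_pos (pos_of_mul_pos_right h2 h3.le)]
  · rw [sign_neg h4, sign_neg]
    by_contra h5
    nlinarith [not_lt.mp h5]

theorem TotallyPos.add {x y : K} (hx : TotallyPos x) (hy : TotallyPos y) : TotallyPos (x + y) :=
  fun σ => by rw [map_add]; exact add_pos (hx σ) (hy σ)

theorem TotallyPos.mul {x y : K} (hx : TotallyPos x) (hy : TotallyPos y) : TotallyPos (x * y) :=
  fun σ => by rw [map_mul]; exact mul_pos (hx σ) (hy σ)

theorem TotallyPos.map {x : K} (hx : TotallyPos x) (τ : K ≃ₐ[ℚ] K) : TotallyPos (τ x) :=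
  fun σ => hx (σ.comp (τ : K →+* K))

theorem totallyPos_sq {x : K} (hx : x ≠ 0) : TotallyPos (x ^ 2) := fun σ => by
  rw [map_pow]
  have : σ x ≠ 0 := by simpa using hx
  positivity

theorem TotallyPos.ne_zero {x : K} (hx : TotallyPos x) : x ≠ 0 := by
  rintro rfl
  simpa using hx (algebraMap K ℝ)

theorem IsAdjoinUnit.mul {u v : K} (hu : IsAdjoinUnit g u) (hv : IsAdjoinUnit g v) :
    IsAdjoinUnit g (u * v) := by
  obtain ⟨ε, rfl⟩ := hu
  obtain ⟨δ, rfl⟩ := hv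
  exact ⟨ε * δ, by simp⟩

theorem IsAdjoinUnit.inv {u : K} (hu : IsAdjoinUnit g u) : IsAdjoinUnit g u⁻¹ := by
  obtain ⟨ε, rfl⟩ := hu
  refine ⟨ε⁻¹, ?_⟩
  apply eq_inv_of_mul_eq_one_left
  exact_mod_cast congrArg (fun t : Algebra.adjoin ℤ {g} => (t : K)) ε.inv_mul

theorem IsAdjoinUnit.mem {u : K} (hu : IsAdjoinUnit g u) : u ∈ Algebra.adjoin ℤ {g} := by
  obtain ⟨ε, rfl⟩ := hu
  exact (ε : Algebra.adjoin ℤ {g}).2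

theorem IsAdjoinUnit.ne_zero {u : K} (hu : IsAdjoinUnit g u) : u ≠ 0 := by
  obtain ⟨ε, rfl⟩ := hu
  intro h
  exact ε.ne_zero (Subtype.ext h)

theorem isAdjoinUnit_of_mul_eq_one {u v : K} (hu : u ∈ Algebra.adjoin ℤ {g})
    (hv : v ∈ Algebra.adjoin ℤ {g}) (h : u * v = 1) : IsAdjoinUnit g u :=
  ⟨⟨⟨u, hu⟩, ⟨v, hv⟩, Subtype.ext h, Subtype.ext (by rw [mul_comm] at h; exact h)⟩, rfl⟩

theorem isAdjoinUnit_one : IsAdjoinUnit g 1 := ⟨1, by simp⟩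

theorem isAdjoinUnit_neg_one : IsAdjoinUnit g (-1) := ⟨-1, by simp⟩

theorem gen_mem : g ∈ Algebra.adjoin ℤ {g} := Algebra.subset_adjoin rfl

theorem quadElt_mem (x y z : ℤ) : quadElt g x y z ∈ Algebra.adjoin ℤ {g} := by
  unfold quadElt
  exact add_mem (add_mem (intCast_mem _ _) (mul_mem (intCast_mem _ _) gen_mem))
    (mul_mem (intCast_mem _ _) (pow_mem gen_mem 2))

/-- Multiplication by a unit preserves indecomposability. -/
theorem IsIndec.unit_mul {u x : K} (hu : IsAdjoinUnit g u) (hx : IsIndec g x) :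
    IsIndec g (u * x) := by
  refine ⟨⟨mul_mem hu.mem hx.1.1, rfl⟩, ?_⟩
  rintro ⟨y, z, ⟨hy, sy⟩, ⟨hz, sz⟩, h⟩
  have key : ∀ w, signature w = signature (u * x) → signature (u⁻¹ * w) = signature x := by
    intro w hw
    rw [signature_mul_eq u⁻¹ hw, inv_mul_cancel_left₀ hu.ne_zero]
  refine hx.2 ⟨u⁻¹ * y, u⁻¹ * z, ⟨mul_mem hu.inv.mem hy, key y sy⟩,
    ⟨mul_mem hu.inv.mem hz, key z sz⟩, ?_⟩
  rw [← mul_add, ← h, inv_mul_cancel_left₀ hu.ne_zero]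

theorem isIndec_unit_mul_iff {u x : K} (hu : IsAdjoinUnit g u) :
    IsIndec g (u * x) ↔ IsIndec g x := by
  refine ⟨fun h => ?_, fun h => h.unit_mul hu⟩
  have := h.unit_mul hu.inv
  rwa [inv_mul_cancel_left₀ hu.ne_zero] at this

end basic

/-! ### The order `ℤ[g]` and the action of `τ` on it. -/

namespace SimplestCubic

variable {K : IntermediateField ℚ ℝ} {a : ℤ} {g : K} {τ : K ≃ₐ[ℚ] K}

theorem gen_ne_zero (h : SimplestCubic a g τ) : g ≠ 0 := by
  intro h0
  have := h.root
  simp [h0] at this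

theorem gen_add_one_ne_zero (h : SimplestCubic a g τ) : g + 1 ≠ 0 := by
  intro h0
  have h1 := h.root
  have : g = -1 := by linear_combination h0
  rw [this] at h1
  have : (1 : K) = 0 := by linear_combination h1
  exact one_ne_zero this

theorem isAdjoinUnit_gen (h : SimplestCubic a g τ) : IsAdjoinUnit g g := by
  refine isAdjoinUnit_of_mul_eq_one gen_mem (quadElt_mem (-(a + 3)) (-a) 1) ?_
  simp only [quadElt]; push_cast
  linear_combination h.root

theorem isAdjoinUnit_gen_add_one (h : SimplestCubic a g τ) : IsAdjoinUnit g (g + 1) := by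
  refine isAdjoinUnit_of_mul_eq_one (add_mem gen_mem (one_mem _))
    (quadElt_mem 2 (a + 1) (-1)) ?_
  simp only [quadElt]; push_cast
  linear_combination -h.root

theorem map_gen (h : SimplestCubic a g τ) : τ g = -(g + 1) / g := by
  rw [eq_div_iff h.gen_ne_zero]
  linear_combination h.conj

theorem map_map_gen (h : SimplestCubic a g τ) : τ (τ g) = -1 / (g + 1) := by
  have h0 := h.gen_ne_zero
  have h1 := h.gen_add_one_ne_zero
  rw [h.map_gen, map_div₀, map_neg, map_add, map_one, h.map_gen]
  have : -(g + 1) / g ≠ 0 := div_ne_zero (neg_ne_zero.mpr h1) h0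
  field_simp
  ring

theorem map_map_map (h : SimplestCubic a g τ) : τ (τ (τ g)) = g := by
  have h0 := h.gen_ne_zero
  have h1 := h.gen_add_one_ne_zero
  rw [h.map_map_gen, map_div₀, map_neg, map_add, map_one, h.map_gen]
  field_simp
  ring

theorem mem_adjoin_iff (h : SimplestCubic a g τ) {x : K} :
    x ∈ Algebra.adjoin ℤ {g} ↔ ∃ p q r : ℤ, x = quadElt g p q r := by
  constructor
  · intro hx
    induction hx using Algebra.adjoin_induction with
    | mem x hx =>
      rw [Set.mem_singleton_iff] at hx
      exact ⟨0, 1, 0, by simp [quadElt, hx]⟩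
    | algebraMap n => exact ⟨n, 0, 0, by simp [quadElt]⟩
    | add x y _ _ hx hy =>
      obtain ⟨p, q, r, rfl⟩ := hx
      obtain ⟨p', q', r', rfl⟩ := hy
      refine ⟨p + p', q + q', r + r', ?_⟩
      simp only [quadElt]; push_cast; ring
    | mul x y _ _ hx hy =>
      obtain ⟨p, q, r, rfl⟩ := hx
      obtain ⟨p', q', r', rfl⟩ := hy
      refine ⟨p * p' + (q * r' + r * q') + r * r' * a,
        p * q' + q * p' + (q * r' + r * q') * (a + 3) + r * r' * (a * (a + 3) + 1),
        p * r' + q * q' + r * p' + (q * r' + r * q') * a + r * r' * (a ^ 2 + a + 3), ?_⟩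
      simp only [quadElt]; push_cast
      linear_combination ((q * r' + r * q' : K) + r * r' * (g + a)) * h.root
  · rintro ⟨p, q, r, rfl⟩
    exact quadElt_mem p q r

theorem map_mem (h : SimplestCubic a g τ) {x : K} (hx : x ∈ Algebra.adjoin ℤ {g}) :
    τ x ∈ Algebra.adjoin ℤ {g} := by
  have hg : τ g ∈ Algebra.adjoin ℤ {g} := by
    rw [h.map_gen, div_eq_mul_inv]
    exact mul_mem (neg_mem (add_mem gen_mem (one_mem _))) h.isAdjoinUnit_gen.inv.mem
  obtain ⟨p, q, r, rfl⟩ := h.mem_adjoin_iff.mp hx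
  simp only [quadElt, map_add, map_mul, map_pow, map_intCast]
  exact add_mem (add_mem (intCast_mem _ _) (mul_mem (intCast_mem _ _) hg))
    (mul_mem (intCast_mem _ _) (pow_mem hg 2))

theorem map_map_map_of_mem (h : SimplestCubic a g τ) {x : K} (hx : x ∈ Algebra.adjoin ℤ {g}) :
    τ (τ (τ x)) = x := by
  obtain ⟨p, q, r, rfl⟩ := h.mem_adjoin_iff.mp hx
  simp only [quadElt, map_add, map_mul, map_pow, map_intCast, h.map_map_map]

theorem isIndec_map (h : SimplestCubic a g τ) {x : K} (hx : IsIndec g x) : IsIndec g (τ x) := by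
  refine ⟨⟨h.map_mem hx.1.1, rfl⟩, ?_⟩
  rintro ⟨y, z, ⟨hy, sy⟩, ⟨hz, sz⟩, e⟩
  have key : ∀ w, signature w = signature (τ x) → signature (τ (τ w)) = signature x := by
    intro w hw
    rw [signature_map_eq τ (signature_map_eq τ hw), h.map_map_map_of_mem hx.1.1]
  refine hx.2 ⟨τ (τ y), τ (τ z), ⟨h.map_mem (h.map_mem hy), key y sy⟩,
    ⟨h.map_mem (h.map_mem hz), key z sz⟩, ?_⟩
  rw [← map_add, ← map_add, ← e, h.map_map_map_of_mem hx.1.1]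

/-- The images of the generator under the embeddings satisfy the cubic equation. -/
theorem root_map (h : SimplestCubic a g τ) (σ : K →+* ℝ) :
    σ g ^ 3 = a * σ g ^ 2 + (a + 3) * σ g + 1 := by
  simpa only [map_pow, map_add, map_mul, map_intCast, map_ofNat, map_one] using congrArg σ h.root

theorem root_real (h : SimplestCubic a g τ) :
    (g : ℝ) ^ 3 = a * (g : ℝ) ^ 2 + (a + 3) * (g : ℝ) + 1 :=
  h.root_map (algebraMap K ℝ)

theorem le_real (h : SimplestCubic a g τ) : (15 : ℝ) ≤ a := by exact_mod_cast h.le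

end SimplestCubic

/-! ### Real roots and trace functionals. -/

/-- The location of the three real roots. -/
theorem simplestCubic_root_cases {a t : ℝ} (ha : 15 ≤ a)
    (ht : t ^ 3 = a * t ^ 2 + (a + 3) * t + 1) :
    (a + 1 < t ∧ t < a + 2) ∨ (-2 < t ∧ t < -1) ∨ (-1 < (a + 2) * t ∧ t < 0) := by
  rcases lt_trichotomy t 0 with h0 | h0 | h0
  · right
    rcases lt_trichotomy t (-1) with h1 | h1 | h1
    · left
      refine ⟨?_, h1⟩
      by_contra h2
      push Not at h2
      nlinarith [mul_nonneg (neg_nonneg.mpr h0.le) (neg_nonneg.mpr h0.le),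
        mul_nonneg (sub_nonneg.mpr h2) (sub_nonneg.mpr h1.le)]
    · rw [h1] at ht; linarith
    · right
      refine ⟨?_, h0⟩
      have : t * (t + 1) * (t - 1 - a) = 2 * t + 1 := by linear_combination ht
      by_contra h2
      push Not at h2
      nlinarith [mul_pos (neg_pos.mpr h0) (by linarith : 0 < t + 1), mul_nonneg (mul_pos (neg_pos.mpr h0) (by linarith : 0 < t + 1)).le (neg_nonneg.mpr h0.le)]
  · rw [h0] at ht; norm_num at ht
  · left
    have key : t * (t + 1) * (t - 1 - a) = 2 * t + 1 := by linear_combination ht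
    have h1 : a + 1 < t := by
      by_contra h2
      push Not at h2
      nlinarith [mul_nonneg (by positivity : 0 ≤ t * (t + 1)) (sub_nonneg.mpr h2)]
    refine ⟨h1, ?_⟩
    by_contra h2
    push Not at h2
    nlinarith [mul_nonneg (by positivity : 0 ≤ t * (t + 1)) (sub_nonneg.mpr h2)]

namespace SimplestCubic

variable {K : IntermediateField ℚ ℝ} {a : ℤ} {g : K} {τ : K ≃ₐ[ℚ] K}

theorem gen_pos (h : SimplestCubic a g τ) : (0 : ℝ) < g := by
  have := h.lt; have := h.le_real; linarith

theorem coe_map_gen (h : SimplestCubic a g τ) : ((τ g : K) : ℝ) = -((g : ℝ) + 1) / g := by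
  rw [h.map_gen]; push_cast; rfl

theorem coe_map_map_gen (h : SimplestCubic a g τ) :
    ((τ (τ g) : K) : ℝ) = -1 / ((g : ℝ) + 1) := by
  rw [h.map_map_gen]; push_cast; rfl

theorem coe_quadElt (x y z : ℤ) : ((quadElt g x y z : K) : ℝ) = x + y * (g : ℝ) + z * (g : ℝ) ^ 2 := by
  simp [quadElt]

theorem coe_map_quadElt (h : SimplestCubic a g τ) (x y z : ℤ) :
    ((τ (quadElt g x y z) : K) : ℝ) =
      x + y * (-((g : ℝ) + 1) / g) + z * (-((g : ℝ) + 1) / g) ^ 2 := by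
  rw [← h.coe_map_gen]; simp [quadElt]

theorem coe_map_map_quadElt (h : SimplestCubic a g τ) (x y z : ℤ) :
    ((τ (τ (quadElt g x y z)) : K) : ℝ) =
      x + y * (-1 / ((g : ℝ) + 1)) + z * (-1 / ((g : ℝ) + 1)) ^ 2 := by
  rw [← h.coe_map_map_gen]; simp [quadElt]

/-- The functional `x + y g + z g² ↦ x + z` in terms of the conjugates. -/
theorem add_eq_conjugates (h : SimplestCubic a g τ) (x y z : ℤ) :
    ((g : ℝ) ^ 2 + g + 1) ^ 2 * ((x : ℝ) + z) =
      ((g : ℝ) + 1) ^ 2 * (quadElt g x y z : K) + (g : ℝ) ^ 2 * (τ (quadElt g x y z) : K) +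
        (g : ℝ) ^ 2 * ((g : ℝ) + 1) ^ 2 * (τ (τ (quadElt g x y z)) : K) := by
  rw [h.coe_map_map_quadElt, h.coe_map_quadElt, coe_quadElt]
  have h0 := h.gen_pos
  have h1 : (g : ℝ) + 1 ≠ 0 := by positivity
  field_simp
  ring

/-- The functional `x + y g + z g² ↦ z` in terms of the conjugates. -/
theorem lead_eq_conjugates (h : SimplestCubic a g τ) (x y z : ℤ) :
    ((g : ℝ) ^ 2 + g + 1) ^ 2 * (z : ℝ) =
      (g : ℝ) * ((g : ℝ) + 1) * (quadElt g x y z : K) +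
        (g : ℝ) ^ 2 * ((g : ℝ) + 1) * (τ (quadElt g x y z) : K) -
        (g : ℝ) * ((g : ℝ) + 1) ^ 2 * (τ (τ (quadElt g x y z)) : K) := by
  rw [h.coe_map_map_quadElt, h.coe_map_quadElt, coe_quadElt]
  have h0 := h.gen_pos
  have h1 : (g : ℝ) + 1 ≠ 0 := by positivity
  field_simp
  ring

theorem quadElt_eq_zero (h : SimplestCubic a g τ) {x y z : ℤ} (h0 : quadElt g x y z = 0) :
    x = 0 ∧ y = 0 ∧ z = 0 := by
  have hg := h.gen_pos
  have h1 := h.add_eq_conjugates x y z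
  have h2 := h.lead_eq_conjugates x y z
  rw [h0] at h1 h2
  simp only [map_zero, ZeroMemClass.coe_zero, mul_zero, add_zero, sub_zero, mul_eq_zero] at h1 h2
  have hQ : ((g : ℝ) ^ 2 + g + 1) ^ 2 ≠ 0 := by positivity
  have hz : z = 0 := by exact_mod_cast h2.resolve_left hQ
  have hx : x = 0 := by
    have := h1.resolve_left hQ
    rw [hz] at this
    exact_mod_cast (by simpa using this : (x : ℝ) = 0)
  refine ⟨hx, ?_, hz⟩
  rw [hx, hz] at h0
  simpa [quadElt, h.gen_ne_zero] using h0

theorem quadElt_inj (h : SimplestCubic a g τ) {x y z x' y' z' : ℤ}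
    (h0 : quadElt g x y z = quadElt g x' y' z') : x = x' ∧ y = y' ∧ z = z' := by
  have h1 : quadElt g (x - x') (y - y') (z - z') = 0 := by
    have : quadElt g x y z - quadElt g x' y' z' = 0 := sub_eq_zero.mpr h0
    rw [← this]; simp only [quadElt]; push_cast; ring
  have := h.quadElt_eq_zero h1
  omega

/-- `x + z` is the trace of `δ α` with `δ = ((g + 1)/(g² + g + 1))²`, a square and so totally
positive. -/
theorem one_le_add_of_totallyPos (h : SimplestCubic a g τ) {x y z : ℤ}
    (hp : TotallyPos (quadElt g x y z)) : 1 ≤ x + z := by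
  have hg := h.gen_pos
  have h1 : (0 : ℝ) < (quadElt g x y z : K) := hp (algebraMap K ℝ)
  have h2 : (0 : ℝ) < (τ (quadElt g x y z) : K) := hp.map τ (algebraMap K ℝ)
  have h3 : (0 : ℝ) < (τ (τ (quadElt g x y z)) : K) := (hp.map τ).map τ (algebraMap K ℝ)
  have key := h.add_eq_conjugates x y z
  have : 0 < ((g : ℝ) ^ 2 + g + 1) ^ 2 * ((x : ℝ) + z) := by rw [key]; positivity
  have h4 : (0 : ℝ) < (x : ℝ) + z := pos_of_mul_pos_right this (by positivity)
  have : 0 < x + z := by exact_mod_cast h4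
  omega

/-- Euler's formula gives `z = Tr(α / f'(g))` for the defining cubic `f`, where `f'(g) = (g² + g +
1)² / (g (g + 1))` has the signature of `g (g + 1)`. -/
theorem one_le_lead_of_totallyPos (h : SimplestCubic a g τ) {x y z : ℤ}
    (hp : TotallyPos (g * (g + 1) * quadElt g x y z)) : 1 ≤ z := by
  have hg := h.gen_pos
  have h1 : (0 : ℝ) < (g * (g + 1) * quadElt g x y z : K) := hp (algebraMap K ℝ)
  have h2 : (0 : ℝ) < (τ (g * (g + 1) * quadElt g x y z) : K) := hp.map τ (algebraMap K ℝ)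
  have h3 : (0 : ℝ) < (τ (τ (g * (g + 1) * quadElt g x y z)) : K) :=
    (hp.map τ).map τ (algebraMap K ℝ)
  simp only [map_mul, map_add, map_one] at h2 h3
  push_cast at h1 h2 h3
  rw [h.coe_map_gen] at h2
  rw [h.coe_map_map_gen] at h3
  have key := h.lead_eq_conjugates x y z
  set A := ((quadElt g x y z : K) : ℝ)
  set B := ((τ (quadElt g x y z) : K) : ℝ)
  set C := ((τ (τ (quadElt g x y z)) : K) : ℝ)
  set u := (g : ℝ)
  -- Regrouped around the conjugates of `g (g + 1) α`, all three weights become positive.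
  have e : (u ^ 2 + u + 1) ^ 2 * (z : ℝ) = u * (u + 1) * A +
      u ^ 4 * (-(u + 1) / u * (-(u + 1) / u + 1) * B) +
      (u + 1) ^ 4 * (-1 / (u + 1) * (-1 / (u + 1) + 1) * C) := by
    rw [key]
    field_simp
    ring
  have : 0 < (u ^ 2 + u + 1) ^ 2 * (z : ℝ) := by rw [e]; positivity
  have h4 : (0 : ℝ) < z := pos_of_mul_pos_right this (by positivity)
  exact_mod_cast h4

theorem gen_mul_quadElt (h : SimplestCubic a g τ) (x y z : ℤ) :
    g * quadElt g x y z = quadElt g z (x + (a + 3) * z) (y + a * z) := by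
  simp only [quadElt]; push_cast
  linear_combination (z : K) * h.root

/-- `y + a z` is the leading coefficient of `g α`, so the previous functional applies after
multiplication by `g`. -/
theorem one_le_second_of_totallyPos (h : SimplestCubic a g τ) {x y z : ℤ}
    (hp : TotallyPos ((g + 1) * quadElt g x y z)) : 1 ≤ y + a * z := by
  have := (totallyPos_sq h.gen_ne_zero).mul hp
  apply h.one_le_lead_of_totallyPos (x := z) (y := x + (a + 3) * z)
  rw [← h.gen_mul_quadElt]
  convert this using 1
  ring

/-- An element at which a functional that is positive on its signature has the value one is
indecomposable. -/
theorem isIndec_of_functional (h : SimplestCubic a g τ) (u : K) (c₀ c₁ c₂ : ℤ)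
    (hφ : ∀ x y z : ℤ, TotallyPos (u * quadElt g x y z) → 1 ≤ c₀ * x + c₁ * y + c₂ * z)
    {x y z : ℤ} (hp : TotallyPos (u * quadElt g x y z)) (h1 : c₀ * x + c₁ * y + c₂ * z ≤ 1) :
    IsIndec g (quadElt g x y z) := by
  refine ⟨⟨quadElt_mem _ _ _, rfl⟩, ?_⟩
  rintro ⟨p, q, ⟨hp1, sp⟩, ⟨hq1, sq⟩, e⟩
  obtain ⟨x1, y1, z1, rfl⟩ := h.mem_adjoin_iff.mp hp1
  obtain ⟨x2, y2, z2, rfl⟩ := h.mem_adjoin_iff.mp hq1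
  have i1 := hφ _ _ _ (hp.of_signature_eq sp)
  have i2 := hφ _ _ _ (hp.of_signature_eq sq)
  have e' : quadElt g x y z = quadElt g (x1 + x2) (y1 + y2) (z1 + z2) := by
    rw [e]; simp only [quadElt]; push_cast; ring
  obtain ⟨rfl, rfl, rfl⟩ := h.quadElt_inj e'
  linarith

theorem isIndec_of_add_le_one (h : SimplestCubic a g τ) {x y z : ℤ}
    (hp : TotallyPos (quadElt g x y z)) (h1 : x + z ≤ 1) : IsIndec g (quadElt g x y z) := by
  refine h.isIndec_of_functional 1 1 0 1 ?_ (by rwa [one_mul]) (by linarith)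
  intro x y z hp
  rw [one_mul] at hp
  have := h.one_le_add_of_totallyPos hp
  linarith

theorem isIndec_of_lead_le_one (h : SimplestCubic a g τ) {x y z : ℤ}
    (hp : TotallyPos (g * (g + 1) * quadElt g x y z)) (h1 : z ≤ 1) :
    IsIndec g (quadElt g x y z) := by
  refine h.isIndec_of_functional _ 0 0 1 ?_ hp (by linarith)
  intro x y z hp
  have := h.one_le_lead_of_totallyPos hp
  linarith

theorem isIndec_of_second_le_one (h : SimplestCubic a g τ) {x y z : ℤ}
    (hp : TotallyPos ((g + 1) * quadElt g x y z)) (h1 : y + a * z ≤ 1) :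
    IsIndec g (quadElt g x y z) := by
  refine h.isIndec_of_functional _ 0 1 a ?_ hp (by linarith)
  intro x y z hp
  have := h.one_le_second_of_totallyPos hp
  linarith

theorem totallyPos_one : TotallyPos (1 : K) := fun σ => by simp

theorem isIndec_one (h : SimplestCubic a g τ) : IsIndec g 1 := by
  have e : (1 : K) = quadElt g 1 0 0 := by simp [quadElt]
  rw [e]
  exact h.isIndec_of_add_le_one (by rw [← e]; exact totallyPos_one) (by norm_num)

theorem isIndec_of_isAdjoinUnit (h : SimplestCubic a g τ) {u : K} (hu : IsAdjoinUnit g u) :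
    IsIndec g u := by
  simpa using h.isIndec_one.unit_mul hu

/-- The map `x ↦ g² τ(x)` permutes `1`, `g²`, `(1 + g)²` cyclically. -/
theorem sq_mul_map_quadElt (h : SimplestCubic a g τ) (x y z : ℤ) :
    g ^ 2 * τ (quadElt g x y z) = quadElt g z (2 * z - y) (x - y + z) := by
  have h0 := h.gen_ne_zero
  simp only [quadElt, map_add, map_mul, map_pow, map_intCast, h.map_gen]
  push_cast
  field_simp
  ring

theorem totallyPos_sq_mul_map (h : SimplestCubic a g τ) {x y z : ℤ}
    (hp : TotallyPos (quadElt g x y z)) : TotallyPos (quadElt g z (2 * z - y) (x - y + z)) := by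
  rw [← h.sq_mul_map_quadElt]
  exact (totallyPos_sq h.gen_ne_zero).mul (hp.map τ)

theorem totallyPos_quadElt_one_one_one : TotallyPos (quadElt g 1 1 1) := fun σ => by
  simp only [quadElt, Int.cast_one, one_mul, map_add, map_one, map_pow]
  nlinarith [sq_nonneg (σ g + 1)]

/-- The exceptional indecomposable element. -/
theorem isIndec_quadElt_one_one_one (h : SimplestCubic a g τ) : IsIndec g (quadElt g 1 1 1) := by
  refine ⟨⟨quadElt_mem _ _ _, rfl⟩, ?_⟩
  -- These are `x + z` and its transforms under `α ↦ g² τ(α)`; each equals 2 at `1 + g + g²`.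
  have key : ∀ x y z : ℤ, signature (quadElt g x y z) = signature (quadElt g 1 1 1) →
      1 ≤ x + z ∧ 1 ≤ x - y + 2 * z ∧ 1 ≤ 2 * x - y + z := by
    intro x y z hs
    have hp : TotallyPos (quadElt g x y z) := by
      rw [totallyPos_iff_signature, hs, ← totallyPos_iff_signature]
      exact totallyPos_quadElt_one_one_one
    have h1 := h.one_le_add_of_totallyPos hp
    have h2 := h.one_le_add_of_totallyPos (h.totallyPos_sq_mul_map hp)
    have h3 := h.one_le_add_of_totallyPos (h.totallyPos_sq_mul_map (h.totallyPos_sq_mul_map hp))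
    omega
  rintro ⟨p, q, ⟨hp1, sp⟩, ⟨hq1, sq⟩, e⟩
  obtain ⟨x1, y1, z1, rfl⟩ := h.mem_adjoin_iff.mp hp1
  obtain ⟨x2, y2, z2, rfl⟩ := h.mem_adjoin_iff.mp hq1
  have i1 := key _ _ _ sp
  have i2 := key _ _ _ sq
  have e' : quadElt g 1 1 1 = quadElt g (x1 + x2) (y1 + y2) (z1 + z2) := by
    rw [e]; simp only [quadElt]; push_cast; ring
  -- Both summands must have all three values 1, which forces `x = z` and `2 x = 1`.
  have := h.quadElt_inj e'
  omega

end SimplestCubic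

theorem coe_two {K : IntermediateField ℚ ℝ} : ((2 : K) : ℝ) = 2 := rfl

/-! ### The Jacobi–Perron expansion up to units. -/

section expansion

variable {K : IntermediateField ℚ ℝ}

theorem floor_coe_div {b p : K} {A : ℤ} (hb : (0 : ℝ) < b) (h1 : (A : ℝ) * b ≤ p)
    (h2 : (p : ℝ) < (A + 1) * b) : ⌊((p / b : K) : ℝ)⌋ = A := by
  rw [Int.floor_eq_iff]
  push_cast
  exact ⟨(le_div_iff₀ hb).mpr h1, (div_lt_iff₀ hb).mpr h2⟩

theorem jpaStep_three {b p q : K} {A B : ℤ} (hb : (0 : ℝ) < b) (hA1 : (A : ℝ) * b ≤ p)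
    (hA2 : (p : ℝ) < (A + 1) * b) (hB1 : (B : ℝ) * b ≤ q) (hB2 : (q : ℝ) < (B + 1) * b) :
    jpaStep ![b, p, q] = ![p - A * b, q - B * b, b] := by
  have e1 := floor_coe_div hb hA1 hA2
  have e2 := floor_coe_div hb hB1 hB2
  funext i
  fin_cases i
  · simp [jpaStep, Fin.snoc, ← e1]
  · simp [jpaStep, Fin.snoc, ← e2]
  · simp [jpaStep, Fin.snoc]

/-- The floors involve only ratios of coordinates, so a common factor passes through the step. -/
theorem jpaStep_mul {m : ℕ} {c : K} (hc : c ≠ 0) (β : Fin (m + 1) → K) :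
    jpaStep (fun i => c * β i) = fun i => c * jpaStep β i := by
  funext i
  refine Fin.lastCases ?_ (fun i => ?_) i
  · simp [jpaStep]
  · simp only [jpaStep, Fin.snoc_castSucc, mul_div_mul_left _ _ hc]
    ring

theorem isGeneralizedSemiconvergent_mul {b p q x c : K} (hc : c ≠ 0)
    (h : IsGeneralizedSemiconvergent b p q x) :
    IsGeneralizedSemiconvergent (c * b) (c * p) (c * q) (c * x) := by
  obtain ⟨i, j, h1, h2, h3, rfl⟩ := h
  have e1 : ∀ y : K, c * p - (i : K) * (c * b) - y * (c * q) = c * (p - (i : K) * b - y * q) :=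
    fun y => by ring
  have e2 : c * p - (i : K) * (c * b) = c * (p - (i : K) * b) := by ring
  refine ⟨i, j, by rwa [mul_div_mul_left _ _ hc], ?_, ?_, by ring⟩
  · rw [e1, e2, signature_mul_eq c h2]
  · rw [mul_div_mul_left _ _ hc]
    intro l h4 h5 h6
    refine h3 l h4 h5 ?_
    have e3 : ((l : K) - i) * (c * b) - c * q = c * (((l : K) - i) * b - q) := by ring
    rw [e3, e2] at h6
    have := signature_mul_eq c⁻¹ h6
    rwa [inv_mul_cancel_left₀ hc, inv_mul_cancel_left₀ hc] at this

/-- Up to unit factors, the vectors that occur in the Jacobi--Perron expansion: after the first two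
steps the expansion is periodic with period seven. -/
noncomputable def jpaState (a : ℤ) (g : K) : ℕ → Fin 3 → K
  | 0 => ![g ^ 2, g ^ 2 + g, (g + 1) ^ 2]
  | 1 => ![g, 2 * g + 1, g ^ 2]
  | 2 => ![1, g ^ 2 - (a + 1) * g, g]
  | 3 => ![g ^ 2 - (a + 1) * g - 1, g - (a + 1), 1]
  | 4 => ![2 * g + 1, g, g ^ 2]
  | 5 => ![g, g ^ 2 - (a / 2 : ℤ) * (2 * g + 1), 2 * g + 1]
  | 6 => ![g ^ 2 - a * g - (a / 2 : ℤ), 1, g]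
  | 7 => ![1, g - (g ^ 2 - a * g - (a / 2 : ℤ)), g ^ 2 - a * g - (a / 2 : ℤ)]
  | _ => ![g, g + 1, g ^ 2 + g]

/-- `β` is proportional to the state `s`, the factor being a unit. -/
def AtState (a : ℤ) (g : K) (s : ℕ) (β : Fin 3 → K) : Prop :=
  ∃ c : K, IsAdjoinUnit g c ∧ β = fun i => c * jpaState a g s i

theorem AtState.step {a : ℤ} {g : K} {s s' : ℕ} {d : K} (hd : IsAdjoinUnit g d)
    (hs : jpaStep (jpaState a g s) = fun i => d * jpaState a g s' i)
    {β : Fin 3 → K} (hβ : AtState a g s β) : AtState a g s' (jpaStep β) := by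
  obtain ⟨c, hc, rfl⟩ := hβ
  refine ⟨c * d, hc.mul hd, ?_⟩
  rw [jpaStep_mul hc.ne_zero, hs]
  simp only [mul_assoc]

end expansion

namespace SimplestCubic

variable {K : IntermediateField ℚ ℝ} {a : ℤ} {g : K} {τ : K ≃ₐ[ℚ] K}

theorem lt_add_two (h : SimplestCubic a g τ) : (g : ℝ) < a + 2 := by
  have h1 := h.lt
  have h2 := h.le_real
  rcases simplestCubic_root_cases h2 h.root_real with h3 | h3 | h3
  · exact h3.2
  · linarith
  · linarith

theorem key_real (h : SimplestCubic a g τ) :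
    ((g : ℝ) - (a + 1)) * (g * (g + 1)) = 2 * g + 1 := by
  linear_combination h.root_real

theorem two_mul_half_le (a : ℤ) : (2 : ℝ) * (a / 2 : ℤ) ≤ a := by
  exact_mod_cast Int.mul_ediv_self_le (by norm_num)

theorem le_two_mul_half (a : ℤ) : (a : ℝ) ≤ 2 * (a / 2 : ℤ) + 1 := by
  have : a ≤ 2 * (a / 2) + 1 := by omega
  exact_mod_cast this

theorem seven_le_half (h : SimplestCubic a g τ) : (7 : ℝ) ≤ (a / 2 : ℤ) := by
  have := h.le
  have : 7 ≤ a / 2 := by omega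
  exact_mod_cast this

theorem one_div_bounds (h : SimplestCubic a g τ) :
    0 < 1 / (g : ℝ) ∧ 1 / (g : ℝ) < 1 / 16 ∧ 0 < 1 / ((g : ℝ) + 1) ∧
      1 / ((g : ℝ) + 1) < 1 / 16 := by
  have h1 := h.lt
  have h2 := h.le_real
  have h0 := h.gen_pos
  refine ⟨by positivity, ?_, by positivity, ?_⟩
  · exact one_div_lt_one_div_of_lt (by norm_num) (by linarith)
  · exact one_div_lt_one_div_of_lt (by norm_num) (by linarith)

/-- The cubic relation divided by `g (g + 1)`, in partial fractions. This and the next two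
identities isolate the small terms that decide the floors. -/
theorem sub_eq_real (h : SimplestCubic a g τ) :
    (g : ℝ) - (a + 1) = 1 / (g : ℝ) + 1 / ((g : ℝ) + 1) := by
  have h0 := h.gen_pos
  have h1 : (g : ℝ) + 1 ≠ 0 := by positivity
  field_simp
  linear_combination h.key_real

theorem sq_sub_eq_real (h : SimplestCubic a g τ) :
    (g : ℝ) ^ 2 - (a + 1) * g = 2 - 1 / ((g : ℝ) + 1) := by
  have h0 := h.gen_pos
  have h1 : (g : ℝ) + 1 ≠ 0 := by positivity
  field_simp
  linear_combination h.root_real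

theorem sq_sub_sub_eq_real (h : SimplestCubic a g τ) (m : ℝ) :
    (g : ℝ) ^ 2 - a * g - m = a - m + 3 + 1 / (g : ℝ) := by
  have h0 := h.gen_pos
  field_simp
  linear_combination h.root_real

theorem jpaStep_state_zero (h : SimplestCubic a g τ) :
    jpaStep (jpaState a g 0) = jpaState a g 1 := by
  have h1 := h.lt
  have h2 := h.le_real
  have h0 := h.gen_pos
  simp only [jpaState]
  rw [jpaStep_three (A := 1) (B := 1)]
  · congr 1
    · push_cast; ring
    · congr 1
      push_cast; ring
  all_goals (push_cast [coe_two]; nlinarith)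

theorem jpaStep_state_one (h : SimplestCubic a g τ) :
    jpaStep (jpaState a g 1) = jpaState a g 2 := by
  have h1 := h.lt
  have h2 := h.le_real
  have h0 := h.gen_pos
  have h3 := h.lt_add_two
  simp only [jpaState]
  rw [jpaStep_three (A := 2) (B := a + 1)]
  · congr 1
    · push_cast; ring
    · congr 1
      push_cast; ring
  all_goals (push_cast [coe_two]; nlinarith)

theorem jpaStep_state_two (h : SimplestCubic a g τ) :
    jpaStep (jpaState a g 2) = jpaState a g 3 := by
  have h1 := h.lt
  have h2 := h.le_real
  have h3 := h.lt_add_two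
  have h4 := h.sq_sub_eq_real
  have h5 := h.one_div_bounds
  simp only [jpaState]
  rw [jpaStep_three (A := 1) (B := a + 1)]
  · congr 1
    · push_cast; ring
    · congr 1
      push_cast; ring
  all_goals (push_cast [coe_two]; linarith)

/-- The new vector is `(1/g + 1/(g + 1), 1/(g + 1), g/(g + 1))`; clearing denominators gives state
4. -/
theorem jpaStep_state_three (h : SimplestCubic a g τ) :
    jpaStep (jpaState a g 3) = fun i => (g * (g + 1))⁻¹ * jpaState a g 4 i := by
  have h1 := h.lt
  have h2 := h.le_real
  have h4 := h.sq_sub_eq_real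
  have h5 := h.one_div_bounds
  have h6 := h.sub_eq_real
  have h7 := h.gen_ne_zero
  have h8 := h.gen_add_one_ne_zero
  simp only [jpaState]
  rw [jpaStep_three (A := 0) (B := 1)]
  · funext i
    fin_cases i
    · simp
      field_simp
      linear_combination h.root
    · simp
      field_simp
      linear_combination -h.root
    · simp
      field_simp
      linear_combination h.root
  all_goals (push_cast [coe_two]; linarith)

theorem sq_eq_real (h : SimplestCubic a g τ) (m : ℝ) :
    (g : ℝ) ^ 2 - m * (2 * g + 1) = (a - 2 * m + 1) * g + (2 - m) - 1 / ((g : ℝ) + 1) := by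
  linear_combination h.sq_sub_eq_real

theorem jpaStep_state_four (h : SimplestCubic a g τ) :
    jpaStep (jpaState a g 4) = jpaState a g 5 := by
  have h1 := h.lt
  have h2 := h.le_real
  have h3 := h.lt_add_two
  have h5 := h.one_div_bounds
  have h6 := h.sq_eq_real (a / 2 : ℤ)
  have h7 := two_mul_half_le a
  have h8 := le_two_mul_half a
  have h9 := h.seven_le_half
  simp only [jpaState]
  rw [jpaStep_three (A := 0) (B := a / 2)]
  · congr 1
    · push_cast; ring
  all_goals (push_cast [coe_two]; try linarith)
  · nlinarith
  · nlinarith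

/-- The first quotient is the parity of `a`; subtracting it turns `g² - ⌊a/2⌋ (2g + 1)` into `g² - a
g - ⌊a/2⌋`, so both parities continue alike. -/
theorem jpaStep_state_five (h : SimplestCubic a g τ) :
    jpaStep (jpaState a g 5) = jpaState a g 6 := by
  have h1 := h.lt
  have h2 := h.le_real
  have h3 := h.lt_add_two
  have h5 := h.one_div_bounds
  have h6 := h.sq_eq_real (a / 2 : ℤ)
  have h7 := two_mul_half_le a
  have h8 := le_two_mul_half a
  have h9 := h.seven_le_half
  simp only [jpaState]
  rw [jpaStep_three (A := a - 2 * (a / 2)) (B := 2)]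
  · congr 1
    · push_cast; ring
    · congr 1
      push_cast; ring
  all_goals (push_cast [coe_two]; linarith)

theorem jpaStep_state_six (h : SimplestCubic a g τ) :
    jpaStep (jpaState a g 6) = jpaState a g 7 := by
  have h1 := h.lt
  have h2 := h.le_real
  have h3 := h.lt_add_two
  have h5 := h.one_div_bounds
  have h6 := h.sq_sub_sub_eq_real (a / 2 : ℤ)
  have h7 := two_mul_half_le a
  have h8 := le_two_mul_half a
  have h9 := h.seven_le_half
  simp only [jpaState]
  rw [jpaStep_three (A := 0) (B := 1)]
  · congr 1
    · push_cast; ring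
    · congr 1
      push_cast; ring
  all_goals (push_cast [coe_two]; linarith)

theorem jpaStep_state_seven (h : SimplestCubic a g τ) :
    jpaStep (jpaState a g 7) = fun i => (g * (g + 1))⁻¹ * jpaState a g 8 i := by
  have h1 := h.lt
  have h2 := h.le_real
  have h4 := h.sub_eq_real
  have h5 := h.one_div_bounds
  have h6 := h.sq_sub_sub_eq_real (a / 2 : ℤ)
  have h7 := h.gen_ne_zero
  have h8 := h.gen_add_one_ne_zero
  simp only [jpaState]
  rw [jpaStep_three (A := a / 2 - 2) (B := a - a / 2 + 3)]
  · funext i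
    fin_cases i
    · simp
      field_simp
      linear_combination -h.root
    · simp
      field_simp
      linear_combination h.root
    · simp
      field_simp
  all_goals (push_cast [coe_two]; linarith)

theorem jpaStep_state_eight (h : SimplestCubic a g τ) :
    jpaStep (jpaState a g 8) = jpaState a g 2 := by
  have h1 := h.lt
  have h2 := h.le_real
  have h0 := h.gen_pos
  have h3 := h.lt_add_two
  simp only [jpaState]
  rw [jpaStep_three (A := 1) (B := a + 2)]
  · congr 1
    · push_cast; ring
    · congr 1
      push_cast; ring
  all_goals (push_cast [coe_two]; nlinarith)

theorem isAdjoinUnit_inv (h : SimplestCubic a g τ) : IsAdjoinUnit g (g * (g + 1))⁻¹ :=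
  (h.isAdjoinUnit_gen.mul h.isAdjoinUnit_gen_add_one).inv

theorem atState_step_lt_eight (h : SimplestCubic a g τ) {s : ℕ} (hs : s < 8) {β : Fin 3 → K}
    (hβ : AtState a g s β) : AtState a g (s + 1) (jpaStep β) := by
  interval_cases s
  · exact hβ.step isAdjoinUnit_one (by rw [h.jpaStep_state_zero]; simp only [one_mul])
  · exact hβ.step isAdjoinUnit_one (by rw [h.jpaStep_state_one]; simp only [one_mul])
  · exact hβ.step isAdjoinUnit_one (by rw [h.jpaStep_state_two]; simp only [one_mul])
  · exact hβ.step h.isAdjoinUnit_inv h.jpaStep_state_three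
  · exact hβ.step isAdjoinUnit_one (by rw [h.jpaStep_state_four]; simp only [one_mul])
  · exact hβ.step isAdjoinUnit_one (by rw [h.jpaStep_state_five]; simp only [one_mul])
  · exact hβ.step isAdjoinUnit_one (by rw [h.jpaStep_state_six]; simp only [one_mul])
  · exact hβ.step h.isAdjoinUnit_inv h.jpaStep_state_seven

theorem atState_step_eight (h : SimplestCubic a g τ) {β : Fin 3 → K}
    (hβ : AtState a g 8 β) : AtState a g 2 (jpaStep β) :=
  hβ.step isAdjoinUnit_one (by rw [h.jpaStep_state_eight]; simp only [one_mul])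

theorem atState_zero (h : SimplestCubic a g τ) {r : K} (hr : g * r = -(g + 1)) :
    AtState a g 0 ![1, -r, r ^ 2] := by
  refine ⟨(g * g)⁻¹, (h.isAdjoinUnit_gen.mul h.isAdjoinUnit_gen).inv, ?_⟩
  have h0 := h.gen_ne_zero
  have e : r = -(g + 1) / g := by rw [eq_div_iff h0]; linear_combination hr
  subst e
  funext i
  fin_cases i
  · simp [jpaState]; field_simp
  · simp [jpaState]; field_simp; ring
  · simp [jpaState]; field_simp; ring

/-- The converse needs every state to occur, at an index equal to its number; the next lemma gives
the complementary fact that no other vectors occur. -/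
theorem atState_jpaExpansion (h : SimplestCubic a g τ) {r : K} (hr : g * r = -(g + 1)) {k : ℕ}
    (hk : k ≤ 8) : AtState a g k (jpaExpansion ![1, -r, r ^ 2] k) := by
  induction k with
  | zero => exact h.atState_zero hr
  | succ k ih =>
    simp only [jpaExpansion, Function.iterate_succ', Function.comp] at ih ⊢
    exact h.atState_step_lt_eight (by omega) (ih (by omega))

theorem exists_atState_jpaExpansion (h : SimplestCubic a g τ) {r : K} (hr : g * r = -(g + 1))
    (k : ℕ) : ∃ s ≤ 8, AtState a g s (jpaExpansion ![1, -r, r ^ 2] k) := by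
  induction k with
  | zero => exact ⟨0, by norm_num, h.atState_zero hr⟩
  | succ k ih =>
    obtain ⟨s, hs, ih⟩ := ih
    simp only [jpaExpansion, Function.iterate_succ', Function.comp] at ih ⊢
    rcases hs.lt_or_eq with hs | rfl
    · exact ⟨s + 1, hs, h.atState_step_lt_eight hs ih⟩
    · exact ⟨2, by norm_num, h.atState_step_eight ih⟩

end SimplestCubic

/-! ### Indecomposability of the semiconvergents. -/

section

variable {K : IntermediateField ℚ ℝ}

theorem TotallyPos.of_signature_eq' {x y : K} (h : signature x = signature y)
    (hy : TotallyPos y) : TotallyPos x := by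
  rwa [totallyPos_iff_signature, h, ← totallyPos_iff_signature]

end

namespace SimplestCubic

variable {K : IntermediateField ℚ ℝ} {a : ℤ} {g : K} {τ : K ≃ₐ[ℚ] K}

theorem root_cases (h : SimplestCubic a g τ) (σ : K →+* ℝ) :
    (a + 1 < σ g ∧ σ g < a + 2) ∨ (-2 < σ g ∧ σ g < -1) ∨
      (-1 < ((a : ℝ) + 2) * σ g ∧ σ g < 0) :=
  simplestCubic_root_cases h.le_real (h.root_map σ)

/-- The interval `[0, a + 1]` separates the largest root from the two negative ones, so `g` and `g -
i` have equal signs at each embedding. -/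
theorem totallyPos_sq_sub (h : SimplestCubic a g τ) {i : ℝ} {x : K} (h0 : 0 ≤ i) (h1 : i ≤ a + 1)
    (hx : ∀ σ : K →+* ℝ, σ x = σ g * (σ g - i)) :
    TotallyPos x := by
  intro σ
  have ha := h.le_real
  rw [hx]
  rcases h.root_cases σ with ⟨h3, h4⟩ | ⟨h3, h4⟩ | ⟨h3, h4⟩
  · exact mul_pos (by linarith) (by linarith)
  · exact mul_pos_of_neg_of_neg (by linarith) (by linarith)
  · exact mul_pos_of_neg_of_neg (by linarith) (by linarith)

/-- The semiconvergent at the unit `g + 1`. -/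
theorem isIndec_state_one_two (h : SimplestCubic a g τ) {x : K}
    (hx : IsGeneralizedSemiconvergent g (2 * g + 1) (g ^ 2) x) : IsIndec g x := by
  have h0 := h.gen_pos
  have h1 := h.lt
  have ha := h.le_real
  obtain ⟨i, j, ⟨hi1, hi2⟩, hs, -, rfl⟩ := hx
  rw [floor_coe_div (A := 2) h0 (by push_cast [coe_two]; linarith)
    (by push_cast [coe_two]; linarith)] at hi2
  obtain rfl : i = 1 := by omega
  have e : 2 * g + 1 - ((1 : ℕ) : K) * g = g + 1 := by push_cast; ring
  rw [e] at hs ⊢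
  have h2 := signature_eq_iff.mp hs (algebraMap K ℝ)
  have h3 : SignType.sign (algebraMap K ℝ (g + 1)) = 1 := by
    rw [sign_eq_one_iff]
    change (0 : ℝ) < ((g + 1 : K) : ℝ)
    push_cast; linarith
  rw [h3, sign_eq_one_iff] at h2
  change (0 : ℝ) < ((g + 1 - (j : K) * g ^ 2 : K) : ℝ) at h2
  push_cast at h2
  have hj : j = 0 := by
    by_contra hj
    have : (1 : ℝ) ≤ j := by exact_mod_cast Nat.one_le_iff_ne_zero.mpr hj
    nlinarith [mul_nonneg (sub_nonneg.mpr this) (sq_nonneg (g : ℝ))]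
  subst hj
  simpa using h.isIndec_of_isAdjoinUnit h.isAdjoinUnit_gen_add_one

/-- The functional `x + z` takes the value `1 - j`. -/
theorem isIndec_state_one_three (h : SimplestCubic a g τ) {x : K}
    (hx : IsGeneralizedSemiconvergent g (g ^ 2) (2 * g + 1) x) : IsIndec g x := by
  have h0 := h.gen_pos
  have h1 := h.lt
  have h2 := h.lt_add_two
  obtain ⟨i, j, ⟨hi1, hi2⟩, hs, -, rfl⟩ := hx
  rw [floor_coe_div (A := a + 1) h0 (by push_cast; nlinarith) (by push_cast; nlinarith)] at hi2
  have hp : TotallyPos (g ^ 2 - (i : K) * g) := by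
    refine h.totallyPos_sq_sub (i := i) (by positivity) ?_ (fun σ => by simp; ring)
    have : (i : ℤ) ≤ a + 1 := by omega
    exact_mod_cast this
  have e : g ^ 2 - (i : K) * g - (j : K) * (2 * g + 1) = quadElt g (-j) (-i - 2 * j) 1 := by
    simp only [quadElt]; push_cast; ring
  rw [e] at hs ⊢
  exact h.isIndec_of_add_le_one (hp.of_signature_eq' hs) (by omega)

/-- After multiplication by the unit `g`, the functional `x + z` is 1 for all `i` and `j`. This
family fills the triangle of height 1. -/
theorem isIndec_state_two_three (h : SimplestCubic a g τ) {x : K}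
    (hx : IsGeneralizedSemiconvergent 1 g (g ^ 2 - (a + 1) * g) x) : IsIndec g x := by
  have h1 := h.lt
  have h2 := h.lt_add_two
  obtain ⟨i, j, ⟨hi1, hi2⟩, hs, -, rfl⟩ := hx
  rw [floor_coe_div (A := a + 1) (by simp) (by push_cast; linarith)
    (by push_cast; linarith)] at hi2
  have hp : TotallyPos (g * (g - (i : K) * 1)) := by
    refine h.totallyPos_sq_sub (i := i) (by positivity) ?_ (fun σ => by simp)
    have : (i : ℤ) ≤ a + 1 := by omega
    exact_mod_cast this
  rw [← isIndec_unit_mul_iff h.isAdjoinUnit_gen]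
  have hq := hp.of_signature_eq hs
  have e : g * (g - (i : K) * 1 - (j : K) * (g ^ 2 - (a + 1) * g)) =
      quadElt g (-j) (-i - (a + 3) * j) (1 + j) := by
    simp only [quadElt]; push_cast
    linear_combination -(j : K) * h.root
  rw [e] at hq ⊢
  exact h.isIndec_of_add_le_one hq (by omega)

/-- The signature is that of `g (g + 1)`, and the leading coefficient is 1. -/
theorem isIndec_state_four_three (h : SimplestCubic a g τ) {x : K}
    (hx : IsGeneralizedSemiconvergent (2 * g + 1) (g ^ 2) g x) : IsIndec g x := by
  have h0 := h.gen_pos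
  have h1 := h.lt
  have h2 := h.lt_add_two
  have ha := h.le_real
  have h5 := h.one_div_bounds
  have h6 := h.sq_eq_real (a / 2 : ℤ)
  have h7 := two_mul_half_le a
  have h8 := le_two_mul_half a
  have h9 := h.seven_le_half
  obtain ⟨i, j, ⟨hi1, hi2⟩, hs, -, rfl⟩ := hx
  rw [floor_coe_div (A := a / 2) (by push_cast [coe_two]; linarith)
    (by push_cast [coe_two]; nlinarith) (by push_cast [coe_two]; nlinarith)] at hi2
  have hi1' : (1 : ℝ) ≤ i := by exact_mod_cast hi1
  have hi2' : (i : ℝ) ≤ (a / 2 : ℤ) - 1 := by exact_mod_cast hi2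
  have hp : TotallyPos (g * (g + 1) * (g ^ 2 - (i : K) * (2 * g + 1))) := by
    intro σ
    simp only [map_mul, map_add, map_sub, map_pow, map_one, map_natCast, map_ofNat]
    rcases h.root_cases σ with ⟨h3, h4⟩ | ⟨h3, h4⟩ | ⟨h3, h4⟩
    · refine mul_pos (mul_pos (by linarith) (by linarith)) ?_
      nlinarith
    · refine mul_pos (mul_pos_of_neg_of_neg (by linarith) (by linarith)) ?_
      nlinarith
    · have h10 : -(1 / 16) < σ g := by nlinarith
      refine mul_pos_of_neg_of_neg (mul_neg_of_neg_of_pos h4 (by linarith)) ?_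
      nlinarith
  have hq := hp.of_signature_eq hs
  have e : g ^ 2 - (i : K) * (2 * g + 1) - (j : K) * g = quadElt g (-i) (-2 * i - j) 1 := by
    simp only [quadElt]; push_cast; ring
  rw [e] at hq ⊢
  exact h.isIndec_of_lead_le_one hq le_rfl

/-- The signature is that of `g + 1`, and `y + a z = 1 - j (a - 2⌊a/2⌋)`. -/
theorem isIndec_state_five_three (h : SimplestCubic a g τ) {x : K}
    (hx : IsGeneralizedSemiconvergent g (2 * g + 1) (g ^ 2 - (a / 2 : ℤ) * (2 * g + 1)) x) :
    IsIndec g x := by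
  have h0 := h.gen_pos
  have h1 := h.lt
  have ha := h.le_real
  obtain ⟨i, j, ⟨hi1, hi2⟩, hs, -, rfl⟩ := hx
  rw [floor_coe_div (A := 2) h0 (by push_cast [coe_two]; linarith)
    (by push_cast [coe_two]; linarith)] at hi2
  obtain rfl : i = 1 := by omega
  have e : 2 * g + 1 - ((1 : ℕ) : K) * g = g + 1 := by push_cast; ring
  rw [e] at hs ⊢
  have hp : TotallyPos ((g + 1) * (g + 1)) := by
    rw [← pow_two]; exact totallyPos_sq h.gen_add_one_ne_zero
  have hq := hp.of_signature_eq hs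
  have e : g + 1 - (j : K) * (g ^ 2 - (a / 2 : ℤ) * (2 * g + 1)) =
      quadElt g (1 + j * (a / 2)) (1 + 2 * j * (a / 2)) (-j) := by
    simp only [quadElt]; push_cast; ring
  rw [e] at hq ⊢
  refine h.isIndec_of_second_le_one hq ?_
  have : 0 ≤ (j : ℤ) * (a - 2 * (a / 2)) := mul_nonneg (by positivity) (by omega)
  linarith

/-- The signature is that of `g + 1`, and `y + a z = 1` for all `i` and `j`. -/
theorem isIndec_state_seven_two (h : SimplestCubic a g τ) {x : K}
    (hx : IsGeneralizedSemiconvergent 1 (g - (g ^ 2 - (a : K) * g - ((a / 2 : ℤ) : K)))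
      (g ^ 2 - (a : K) * g - ((a / 2 : ℤ) : K)) x) : IsIndec g x := by
  have h1 := h.lt
  have h2 := h.lt_add_two
  have ha := h.le_real
  have h5 := h.one_div_bounds
  have h6 := h.sq_sub_sub_eq_real (a / 2 : ℤ)
  have h7 := two_mul_half_le a
  have h8 := le_two_mul_half a
  have h9 := h.seven_le_half
  have h10 := h.sub_eq_real
  obtain ⟨i, j, ⟨hi1, hi2⟩, hs, -, rfl⟩ := hx
  rw [floor_coe_div (A := a / 2 - 2) (by simp) (by push_cast; linarith)
    (by push_cast; linarith)] at hi2
  have hi1' : (1 : ℝ) ≤ i := by exact_mod_cast hi1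
  have hi2' : (i : ℝ) ≤ (a / 2 : ℤ) - 2 - 1 := by exact_mod_cast hi2
  have hp : TotallyPos ((g + 1) * (g - (g ^ 2 - (a : K) * g - ((a / 2 : ℤ) : K)) - (i : K) * 1)) := by
    intro σ
    simp only [map_mul, map_add, map_sub, map_pow, map_one, map_natCast, map_intCast, mul_one]
    rcases h.root_cases σ with ⟨h3, h4⟩ | ⟨h3, h4⟩ | ⟨h3, h4⟩
    · refine mul_pos (by linarith) ?_
      have e := h.root_map σ
      have h11 : 0 < (σ g + 1) * (σ g - (σ g ^ 2 - a * σ g - (a / 2 : ℤ)) - i) := by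
        have : (σ g + 1) * (σ g - (σ g ^ 2 - a * σ g - (a / 2 : ℤ)) - i) =
            (σ g + 1) * ((a / 2 : ℤ) - 2 - i) + 1 := by linear_combination -e
        rw [this]
        have : 0 ≤ (σ g + 1) * ((a / 2 : ℤ) - 2 - i) := mul_nonneg (by linarith) (by linarith)
        linarith
      exact pos_of_mul_pos_right h11 (by linarith)
    · refine mul_pos_of_neg_of_neg (by linarith) ?_
      nlinarith
    · have h10 : -(1 / 16) < σ g := by nlinarith
      refine mul_pos (by linarith) ?_
      nlinarith
  have hq := hp.of_signature_eq hs
  have e : g - (g ^ 2 - (a : K) * g - ((a / 2 : ℤ) : K)) - (i : K) * 1 -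
      (j : K) * (g ^ 2 - (a : K) * g - ((a / 2 : ℤ) : K)) =
      quadElt g (a / 2 - i + j * (a / 2)) (1 + a + j * a) (-1 - j) := by
    simp only [quadElt]; push_cast; ring
  rw [e] at hq ⊢
  exact h.isIndec_of_second_le_one hq (by linarith)

theorem isIndec_state_eight_three (h : SimplestCubic a g τ) {x : K}
    (hx : IsGeneralizedSemiconvergent g (g ^ 2 + g) (g + 1) x) : IsIndec g x := by
  have h0 := h.gen_pos
  have h1 := h.lt
  have h2 := h.lt_add_two
  obtain ⟨i, j, ⟨hi1, hi2⟩, hs, -, rfl⟩ := hx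
  rw [floor_coe_div (A := a + 2) h0 (by push_cast; nlinarith) (by push_cast; nlinarith)] at hi2
  have hp : TotallyPos (g ^ 2 + g - (i : K) * g) := by
    have : (1 : ℝ) ≤ i := by exact_mod_cast hi1
    refine h.totallyPos_sq_sub (i := i - 1) (by linarith) ?_ (fun σ => by simp; ring)
    have : (i : ℤ) ≤ a + 1 := by omega
    have : (i : ℝ) ≤ a + 1 := by exact_mod_cast this
    linarith
  have e : g ^ 2 + g - (i : K) * g - (j : K) * (g + 1) = quadElt g (-j) (1 - i - j) 1 := by
    simp only [quadElt]; push_cast; ring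
  rw [e] at hs ⊢
  exact h.isIndec_of_add_le_one (hp.of_signature_eq' hs) (by omega)

/-- The signature of the semiconvergents `C - i` of the third coordinate of state seven. -/
theorem totallyPos_state_seven (h : SimplestCubic a g τ) {i : ℝ} (hi1 : 1 ≤ i)
    (hi2 : i ≤ a - (a / 2 : ℤ) + 2) {x : K}
    (hx : ∀ σ : K →+* ℝ, σ x = σ g ^ 2 - a * σ g - (a / 2 : ℤ) - i) :
    TotallyPos (g * (g + 1) * x) := by
  intro σ
  have ha := h.le_real
  have h7 := two_mul_half_le a
  have h9 := h.seven_le_half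
  have e := h.root_map σ
  simp only [map_mul, map_add, map_one, hx]
  have e2 : σ g * (σ g ^ 2 - a * σ g - (a / 2 : ℤ) - i) =
      σ g * (a - (a / 2 : ℤ) + 2 - i) + (σ g + 1) := by linear_combination e
  rcases h.root_cases σ with ⟨h3, h4⟩ | ⟨h3, h4⟩ | ⟨h3, h4⟩
  · have : 0 < σ g * (σ g ^ 2 - a * σ g - (a / 2 : ℤ) - i) := by
      rw [e2]
      have : 0 ≤ σ g * (a - (a / 2 : ℤ) + 2 - i) := mul_nonneg (by linarith) (by linarith)
      linarith
    nlinarith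
  · have : σ g * (σ g ^ 2 - a * σ g - (a / 2 : ℤ) - i) < 0 := by
      rw [e2]
      have : 0 ≤ -σ g * (a - (a / 2 : ℤ) + 2 - i) := mul_nonneg (by linarith) (by linarith)
      linarith
    nlinarith
  · have h10 : -(1 / 16) < σ g := by nlinarith
    refine mul_pos_of_neg_of_neg (mul_neg_of_neg_of_pos h4 (by linarith)) ?_
    nlinarith

/-- The elements excluded by the last condition on semiconvergents have the signature of `C - i`. -/
theorem totallyPos_state_seven_excluded (h : SimplestCubic a g τ) :
    TotallyPos (g * (g + 1) * (((a / 2 : ℤ) : K) - 1 - (g - (g ^ 2 - (a : K) * g - ((a / 2 : ℤ) : K))))) := by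
  intro σ
  have ha := h.le_real
  have e := h.root_map σ
  simp only [map_mul, map_add, map_sub, map_pow, map_one, map_intCast]
  have e2 : σ g * (σ g + 1) *
      (((a / 2 : ℤ) : ℝ) - 1 - (σ g - (σ g ^ 2 - a * σ g - (a / 2 : ℤ)))) = σ g ^ 2 := by
    linear_combination σ g * e
  rw [e2]
  have : σ g ≠ 0 := by simpa using h.gen_ne_zero
  positivity

/-- The one family for which the third condition on semiconvergents is needed. For `j = 0` the
leading coefficient is 1; for `j > 0` only associates of `1 + g + g²` and of `1` survive. -/
theorem isIndec_state_seven_three (h : SimplestCubic a g τ) {x : K}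
    (hx : IsGeneralizedSemiconvergent 1 (g ^ 2 - (a : K) * g - ((a / 2 : ℤ) : K))
      (g - (g ^ 2 - (a : K) * g - ((a / 2 : ℤ) : K))) x) : IsIndec g x := by
  have h0 := h.gen_pos
  have h1 := h.lt
  have h2 := h.lt_add_two
  have ha := h.le_real
  have h5 := h.one_div_bounds
  have h6 := h.sq_sub_sub_eq_real (a / 2 : ℤ)
  have h7 := two_mul_half_le a
  have h8 := le_two_mul_half a
  have h9 := h.seven_le_half
  have h10 := h.sub_eq_real
  obtain ⟨i, j, ⟨hi1, hi2⟩, hs, h3, rfl⟩ := hx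
  rw [floor_coe_div (A := a - a / 2 + 3) (by simp) (by push_cast; linarith)
    (by push_cast; linarith)] at hi2 h3
  have hi1' : (1 : ℝ) ≤ i := by exact_mod_cast hi1
  have hi2' : (i : ℝ) ≤ a - (a / 2 : ℤ) + 2 := by
    have : (i : ℤ) ≤ a - a / 2 + 2 := by omega
    exact_mod_cast this
  have hp : TotallyPos (g * (g + 1) * (g ^ 2 - (a : K) * g - ((a / 2 : ℤ) : K) - (i : K) * 1)) :=
    h.totallyPos_state_seven hi1' hi2' (fun σ => by simp)
  have ha15 := h.le
  -- For smaller `i`, the index `l = i + ⌊a/2⌋ - 1` is admissible, and its element times `g (g + 1)`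
  -- is `g²`, contradicting the third condition.
  have hi : a - 2 * (a / 2) + 4 ≤ (i : ℤ) := by
    by_contra hi
    obtain ⟨m, hm⟩ : ∃ m : ℕ, (m : ℤ) = a / 2 - 1 := ⟨(a / 2 - 1).toNat, by omega⟩
    refine h3 (i + m) (by omega) (by push_cast; omega) ?_
    refine TotallyPos.signature_eq (u := g * (g + 1)) ?_ hp
    convert h.totallyPos_state_seven_excluded using 2
    have : (m : K) = (a / 2 : ℤ) - 1 := by exact_mod_cast congrArg (fun t : ℤ => (t : K)) hm
    push_cast
    rw [this]
    ring
  have hq := hp.of_signature_eq hs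
  rcases Nat.eq_zero_or_pos j with hj | hj
  · subst hj
    have e : g ^ 2 - (a : K) * g - ((a / 2 : ℤ) : K) - (i : K) * 1 -
        ((0 : ℕ) : K) * (g - (g ^ 2 - (a : K) * g - ((a / 2 : ℤ) : K))) = quadElt g (-(a / 2) - i) (-a) 1 := by
      simp only [quadElt]; push_cast; ring
    rw [e] at hq ⊢
    exact h.isIndec_of_lead_le_one hq le_rfl
  · have hq1 : (0 : ℝ) < (g ^ 2 - (a : K) * g - ((a / 2 : ℤ) : K) - (i : K) * 1 -
        (j : K) * (g - (g ^ 2 - (a : K) * g - ((a / 2 : ℤ) : K))) : K) := by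
      have := hq (algebraMap K ℝ)
      rw [map_mul] at this
      refine pos_of_mul_pos_right this ?_
      change (0 : ℝ) ≤ ((g * (g + 1) : K) : ℝ)
      push_cast; positivity
    push_cast at hq1
    have hi' : (a : ℝ) - 2 * (a / 2 : ℤ) + 4 ≤ i := by exact_mod_cast hi
    have e1 : (g : ℝ) - ((g : ℝ) ^ 2 - a * g - (a / 2 : ℤ)) =
        (a / 2 : ℤ) - 2 + 1 / ((g : ℝ) + 1) := by linarith
    rw [e1, h6] at hq1
    -- At the identity embedding the element without its `j` term is at most `⌊a/2⌋ - 1 + 1/g`, less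
    -- than twice the subtracted `⌊a/2⌋ - 2 + 1/(g + 1)`.
    have hj1 : j = 1 := by
      by_contra hj1
      have : (2 : ℝ) ≤ j := by
        have : 2 ≤ j := by omega
        exact_mod_cast this
      nlinarith [mul_nonneg (sub_nonneg.mpr this)
        (by linarith : (0 : ℝ) ≤ (a / 2 : ℤ) - 2 + 1 / ((g : ℝ) + 1))]
    subst hj1
    have hi5 : (i : ℤ) ≤ a - 2 * (a / 2) + 5 := by
      by_contra hi5
      have : a - 2 * (a / 2) + 6 ≤ (i : ℤ) := by omega
      have : (a : ℝ) - 2 * (a / 2 : ℤ) + 6 ≤ i := by exact_mod_cast this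
      push_cast at hq1
      linarith
    have hgu := h.isAdjoinUnit_gen.mul h.isAdjoinUnit_gen_add_one
    rw [← isIndec_unit_mul_iff hgu]
    have hcase : (i : ℤ) = a - 2 * (a / 2) + 4 ∨ (i : ℤ) = a - 2 * (a / 2) + 5 := by omega
    have hiK : (i : K) = ((i : ℤ) : K) := by push_cast; rfl
    rcases hcase with hc | hc
    · convert h.isIndec_quadElt_one_one_one using 1
      rw [hiK, hc]
      simp only [quadElt]; push_cast
      linear_combination (2 * g + 1 : K) * h.root
    · convert h.isIndec_one using 1
      rw [hiK, hc]
      push_cast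
      linear_combination (2 * g + 1 : K) * h.root

/-- No semiconvergents occur when the quotient is less than two. -/
theorem not_isGeneralizedSemiconvergent {b p q x : K} (hb : (0 : ℝ) < b) (h2 : (p : ℝ) < 2 * b) : ¬ IsGeneralizedSemiconvergent b p q x := by
  rintro ⟨i, j, ⟨hi1, hi2⟩, -⟩
  have : ⌊((p / b : K) : ℝ)⌋ < 2 := by
    rw [Int.floor_lt]
    push_cast
    rw [div_lt_iff₀ hb]
    exact h2
  omega

end SimplestCubic

/-! ### Completeness: reduction of indecomposables to semiconvergents. -/

/-- `α` is, up to a unit and a power of `τ`, one of the semiconvergents that come from the states of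
the Jacobi--Perron expansion. -/
def IsRepresented {K : IntermediateField ℚ ℝ} (a : ℤ) (g : K) (τ : K ≃ₐ[ℚ] K) (α : K) : Prop :=
  ∃ s ≤ 8, ∃ (x u : K) (n : ℕ),
    (IsGeneralizedSemiconvergent (jpaState a g s 0) (jpaState a g s 1) (jpaState a g s 2) x ∨
      IsGeneralizedSemiconvergent (jpaState a g s 0) (jpaState a g s 2) (jpaState a g s 1) x) ∧
    IsAdjoinUnit g u ∧ α = u * (τ ^ n) x

namespace SimplestCubic

variable {K : IntermediateField ℚ ℝ} {a : ℤ} {g : K} {τ : K ≃ₐ[ℚ] K}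

theorem isAdjoinUnit_map (h : SimplestCubic a g τ) {u : K} (hu : IsAdjoinUnit g u) :
    IsAdjoinUnit g (τ u) := by
  refine isAdjoinUnit_of_mul_eq_one (h.map_mem hu.mem) (h.map_mem hu.inv.mem) ?_
  rw [← map_mul, mul_inv_cancel₀ hu.ne_zero, map_one]

theorem isAdjoinUnit_pow_map (h : SimplestCubic a g τ) {u : K} (hu : IsAdjoinUnit g u) (n : ℕ) :
    IsAdjoinUnit g ((τ ^ n) u) := by
  induction n with
  | zero => simpa using hu
  | succ n ih =>
    rw [pow_succ', AlgEquiv.mul_apply]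
    exact h.isAdjoinUnit_map ih

theorem _root_.IsRepresented.of_unit_mul {u α : K} (hu : IsAdjoinUnit g u)
    (hα : IsRepresented a g τ (u * α)) : IsRepresented a g τ α := by
  obtain ⟨s, hs, x, v, n, hx, hv, e⟩ := hα
  refine ⟨s, hs, x, u⁻¹ * v, n, hx, hu.inv.mul hv, ?_⟩
  rw [mul_assoc, ← e, inv_mul_cancel_left₀ hu.ne_zero]

/-- Since `τ³` is the identity on `ℤ[g]`, applying `τ²` undoes `τ`. -/
theorem isRepresented_of_map (h : SimplestCubic a g τ) {α : K} (hα : α ∈ Algebra.adjoin ℤ {g})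
    (hr : IsRepresented a g τ (τ α)) : IsRepresented a g τ α := by
  obtain ⟨s, hs, x, v, n, hx, hv, e⟩ := hr
  refine ⟨s, hs, x, τ (τ v), n + 2, hx, h.isAdjoinUnit_map (h.isAdjoinUnit_map hv), ?_⟩
  have := congrArg (fun y => τ (τ y)) e
  simp only [h.map_map_map_of_mem hα, map_mul] at this
  rw [this, pow_succ', pow_succ', AlgEquiv.mul_apply, AlgEquiv.mul_apply]

/-- State 1 yields the unit `(2g + 1) - g = g + 1`; there `i = 1` is the last index, so the third
condition is vacuous. -/
theorem isRepresented_of_isAdjoinUnit (h : SimplestCubic a g τ) {u : K} (hu : IsAdjoinUnit g u) :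
    IsRepresented a g τ u := by
  have h0 := h.gen_pos
  have h1 := h.lt
  have ha := h.le_real
  refine ⟨1, by norm_num, g + 1, u * (g + 1)⁻¹, 0, Or.inl ⟨1, 0, ?_, ?_, ?_, ?_⟩,
    hu.mul h.isAdjoinUnit_gen_add_one.inv, ?_⟩
  · change 1 ≤ 1 ∧ ((1 : ℕ) : ℤ) ≤ ⌊((((2 * g + 1) / g : K)) : ℝ)⌋ - 1
    rw [floor_coe_div (A := 2) h0 (by push_cast [coe_two]; linarith)
      (by push_cast [coe_two]; linarith)]
    norm_num
  · simp
  · change ∀ l : ℕ, 1 + 1 ≤ l → ((l : ℕ) : ℤ) ≤ ⌊((((2 * g + 1) / g : K)) : ℝ)⌋ - 1 → _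
    rw [floor_coe_div (A := 2) h0 (by push_cast [coe_two]; linarith)
      (by push_cast [coe_two]; linarith)]
    intro l h2 h3
    omega
  · simp [jpaState]; ring
  · rw [pow_zero, AlgEquiv.one_apply, inv_mul_cancel_right₀ h.gen_add_one_ne_zero]

theorem isRepresented_quadElt_one_one_one (h : SimplestCubic a g τ) :
    IsRepresented a g τ (quadElt g 1 1 1) := by
  have h0 := h.gen_pos
  have h1 := h.lt
  have h2 := h.lt_add_two
  have ha := h.le_real
  have h5 := h.one_div_bounds
  have h6 := h.sq_sub_sub_eq_real (a / 2 : ℤ)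
  have h7 := two_mul_half_le a
  have h8 := le_two_mul_half a
  have h9 := h.seven_le_half
  have h10 := h.sub_eq_real
  have ha15 := h.le
  obtain ⟨i, hi⟩ : ∃ i : ℕ, (i : ℤ) = a - 2 * (a / 2) + 4 :=
    ⟨(a - 2 * (a / 2) + 4).toNat, by omega⟩
  have hiK : (i : K) = a - 2 * (a / 2 : ℤ) + 4 := by
    exact_mod_cast congrArg (fun t : ℤ => (t : K)) hi
  have hiR : (i : ℝ) = a - 2 * (a / 2 : ℤ) + 4 := by exact_mod_cast hi
  have hu := h.isAdjoinUnit_gen.mul h.isAdjoinUnit_gen_add_one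
  set C : K := g ^ 2 - (a : K) * g - ((a / 2 : ℤ) : K) with hC
  have hCr : (C : ℝ) = a - (a / 2 : ℤ) + 3 + 1 / (g : ℝ) := by
    rw [← h6, hC]; push_cast; rfl
  have hfl : ⌊((C / 1 : K) : ℝ)⌋ = a - a / 2 + 3 :=
    floor_coe_div (by simp) (by push_cast; linarith) (by push_cast; linarith)
  have e : quadElt g 1 1 1 = g * (g + 1) * (C - (i : K) * 1 - ((1 : ℕ) : K) * (g - C)) := by
    rw [hiK, hC]
    simp only [quadElt]; push_cast
    linear_combination -(2 * g + 1 : K) * h.root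
  have hp : TotallyPos (g * (g + 1) * (C - (i : K) * 1)) :=
    h.totallyPos_state_seven (i := i) (by linarith) (by linarith) (fun σ => by simp [hC])
  have hq := totallyPos_quadElt_one_one_one (g := g)
  rw [e] at hq
  refine ⟨7, by norm_num, C - (i : K) * 1 - ((1 : ℕ) : K) * (g - C), g * (g + 1), 0,
    Or.inr ⟨i, 1, ?_, hq.signature_eq hp, ?_, rfl⟩, hu, ?_⟩
  · change 1 ≤ i ∧ (i : ℤ) ≤ ⌊((C / 1 : K) : ℝ)⌋ - 1
    rw [hfl]
    omega
  · change ∀ l : ℕ, i + 1 ≤ l → (l : ℤ) ≤ ⌊((C / 1 : K) : ℝ)⌋ - 1 →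
      signature (((l : K) - i) * 1 - (g - C)) ≠ signature (C - (i : K) * 1)
    rw [hfl]
    intro l hl1 hl2 hs
    have hl : (l : ℝ) ≤ a - (a / 2 : ℤ) + 3 - 1 := by exact_mod_cast hl2
    have h11 := signature_eq_iff.mp hs (algebraMap K ℝ)
    have h12 : SignType.sign (algebraMap K ℝ (C - (i : K) * 1)) = 1 := by
      rw [sign_eq_one_iff]
      change (0 : ℝ) < ((C - (i : K) * 1 : K) : ℝ)
      push_cast; linarith
    rw [h12, sign_eq_one_iff] at h11
    change (0 : ℝ) < ((((l : K) - i) * 1 - (g - C) : K) : ℝ) at h11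
    push_cast at h11
    linarith
  · rw [pow_zero, AlgEquiv.one_apply, ← e]

theorem coe_map_map_gen_bounds (h : SimplestCubic a g τ) :
    -1 < ((τ (τ g) : K) : ℝ) ∧ ((τ (τ g) : K) : ℝ) < 0 := by
  have h5 := h.one_div_bounds
  rw [h.coe_map_map_gen, neg_div]
  constructor <;> linarith

/-- The semiconvergents of state two, scaled by `g`. -/
theorem isRepresented_triangle (h : SimplestCubic a g τ) {i j : ℕ} (hi : 1 ≤ i) (hia : (i : ℤ) ≤ a)
    (hp : TotallyPos (quadElt g (-j) (-i - (a + 3) * j) (1 + j))) :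
    IsRepresented a g τ (quadElt g (-j) (-i - (a + 3) * j) (1 + j)) := by
  have h1 := h.lt
  have h2 := h.lt_add_two
  have hfl : ⌊((g / 1 : K) : ℝ)⌋ = a + 1 :=
    floor_coe_div (by simp) (by push_cast; linarith) (by push_cast; linarith)
  set q : K := g ^ 2 - ((a : K) + 1) * g with hq
  have e : quadElt g (-j) (-i - (a + 3) * j) (1 + j) =
      g * (g - (i : K) * 1 - (j : K) * q) := by
    simp only [quadElt, hq]; push_cast
    linear_combination (j : K) * h.root
  have hp' : TotallyPos (g * (g - (i : K) * 1)) := by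
    refine h.totallyPos_sq_sub (i := i) (by positivity) ?_ (fun σ => by simp)
    have : (i : ℤ) ≤ a + 1 := by omega
    exact_mod_cast this
  rw [e] at hp
  refine ⟨2, by norm_num, g - (i : K) * 1 - (j : K) * q, g, 0,
    Or.inr ⟨i, j, ?_, hp.signature_eq hp', ?_, rfl⟩, h.isAdjoinUnit_gen, ?_⟩
  · change 1 ≤ i ∧ (i : ℤ) ≤ ⌊((g / 1 : K) : ℝ)⌋ - 1
    rw [hfl]
    omega
  · change ∀ l : ℕ, i + 1 ≤ l → (l : ℤ) ≤ ⌊((g / 1 : K) : ℝ)⌋ - 1 →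
      signature (((l : K) - i) * 1 - q) ≠ signature (g - (i : K) * 1)
    intro l hl1 _ hs
    obtain ⟨h3, h4⟩ := h.coe_map_map_gen_bounds
    have h11 := signature_eq_iff.mp (signature_map_eq τ (signature_map_eq τ hs)) (algebraMap K ℝ)
    have hr : ((τ (τ g) : K) : ℝ) ^ 3 = a * ((τ (τ g) : K) : ℝ) ^ 2 +
        (a + 3) * ((τ (τ g) : K) : ℝ) + 1 :=
      h.root_map ((algebraMap K ℝ).comp ((τ : K →+* K).comp (τ : K →+* K)))
    simp only [hq, map_sub, map_mul, map_natCast, map_one, map_pow, map_add, map_intCast] at h11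
    have h12 : SignType.sign ((algebraMap K ℝ) (τ (τ g)) - (i : ℝ) * 1) = -1 := by
      rw [sign_eq_neg_one_iff]
      have : (1 : ℝ) ≤ i := by exact_mod_cast hi
      change ((τ (τ g) : K) : ℝ) - (i : ℝ) * 1 < 0
      linarith
    rw [h12, sign_eq_neg_one_iff] at h11
    change ((l : ℝ) - i) * 1 - (((τ (τ g) : K) : ℝ) ^ 2 - ((a : ℝ) + 1) * ((τ (τ g) : K) : ℝ)) < 0
      at h11
    have hl : (i : ℝ) + 1 ≤ l := by exact_mod_cast hl1
    set t := ((τ (τ g) : K) : ℝ)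
    have e3 : (t + 1) * (((l : ℝ) - i) * 1 - (t ^ 2 - ((a : ℝ) + 1) * t)) =
        (t + 1) * ((l : ℝ) - i - 1) - t := by linear_combination -hr
    have h13 : 0 ≤ (t + 1) * ((l : ℝ) - i - 1) := mul_nonneg (by linarith) (by linarith)
    nlinarith [mul_neg_of_pos_of_neg (by linarith : 0 < t + 1) h11]
  · rw [pow_zero, AlgEquiv.one_apply, ← e]

/-- The map `x ↦ g² τ²(x)` permutes `1`, `g²`, `g² / (1 + g)²` cyclically. -/
theorem sq_mul_map_map_quadElt (h : SimplestCubic a g τ) (x y z : ℤ) :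
    g ^ 2 * τ (τ (quadElt g x y z)) = quadElt g (-((a + 1) * z + y))
      (-(a + 2) * y - (a ^ 2 + 3 * a + 3) * z) (x + (a + 2) * z + y) := by
  have h0 := h.gen_add_one_ne_zero
  simp only [quadElt, map_add, map_mul, map_pow, map_intCast, h.map_map_gen]
  push_cast
  field_simp
  linear_combination (-(g + 1) * y - ((a + 2) * g + (a + 1)) * z : K) * h.root

theorem totallyPos_sq_mul_map_map (h : SimplestCubic a g τ) {x y z : ℤ}
    (hp : TotallyPos (quadElt g x y z)) : TotallyPos (quadElt g (-((a + 1) * z + y))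
      (-(a + 2) * y - (a ^ 2 + 3 * a + 3) * z) (x + (a + 2) * z + y)) := by
  rw [← h.sq_mul_map_map_quadElt]
  exact (totallyPos_sq h.gen_ne_zero).mul ((hp.map τ).map τ)

theorem isAdjoinUnit_sq (h : SimplestCubic a g τ) : IsAdjoinUnit g (g ^ 2) := by
  rw [pow_two]; exact h.isAdjoinUnit_gen.mul h.isAdjoinUnit_gen

theorem isIndec_sq_mul_map (h : SimplestCubic a g τ) {x y z : ℤ}
    (hi : IsIndec g (quadElt g x y z)) : IsIndec g (quadElt g z (2 * z - y) (x - y + z)) := by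
  rw [← h.sq_mul_map_quadElt]
  exact (h.isIndec_map hi).unit_mul h.isAdjoinUnit_sq

theorem isIndec_sq_mul_map_map (h : SimplestCubic a g τ) {x y z : ℤ}
    (hi : IsIndec g (quadElt g x y z)) : IsIndec g (quadElt g (-((a + 1) * z + y))
      (-(a + 2) * y - (a ^ 2 + 3 * a + 3) * z) (x + (a + 2) * z + y)) := by
  rw [← h.sq_mul_map_map_quadElt]
  exact (h.isIndec_map (h.isIndec_map hi)).unit_mul h.isAdjoinUnit_sq

theorem isRepresented_of_sq_mul_map (h : SimplestCubic a g τ) {x y z : ℤ}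
    (hr : IsRepresented a g τ (quadElt g z (2 * z - y) (x - y + z))) :
    IsRepresented a g τ (quadElt g x y z) := by
  rw [← h.sq_mul_map_quadElt] at hr
  exact h.isRepresented_of_map (quadElt_mem _ _ _) (hr.of_unit_mul h.isAdjoinUnit_sq)

theorem isRepresented_of_sq_mul_map_map (h : SimplestCubic a g τ) {x y z : ℤ}
    (hr : IsRepresented a g τ (quadElt g (-((a + 1) * z + y))
      (-(a + 2) * y - (a ^ 2 + 3 * a + 3) * z) (x + (a + 2) * z + y))) :
    IsRepresented a g τ (quadElt g x y z) := by
  rw [← h.sq_mul_map_map_quadElt] at hr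
  exact h.isRepresented_of_map (quadElt_mem _ _ _)
    (h.isRepresented_of_map (h.map_mem (quadElt_mem _ _ _)) (hr.of_unit_mul h.isAdjoinUnit_sq))

/-- Elements of the cone spanned by `1`, `g²`, `g² / (1 + g)²` are totally positive. -/
theorem totallyPos_of_mem_cone (h : SimplestCubic a g τ) {x y z : ℤ} (hy : y ≤ 0)
    (hx : (a + 1) * y ≤ (a ^ 2 + 3 * a + 3) * x) (hz : -(a + 2) * y ≤ (a ^ 2 + 3 * a + 3) * z)
    (h0 : ¬ (x = 0 ∧ y = 0 ∧ z = 0)) : TotallyPos (quadElt g x y z) := by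
  intro σ
  have ha := h.le
  have hD : 0 < a ^ 2 + 3 * a + 3 := by positivity
  set t := σ g with ht
  have ht0 : t ≠ 0 := by simpa [ht] using h.gen_ne_zero
  have ht1 : t + 1 ≠ 0 := by
    have := (map_ne_zero σ).mpr h.gen_add_one_ne_zero
    rwa [map_add, map_one] at this
  -- Cramer's rule in the basis `1`, `g²`, `g²/(g + 1)²`, of determinant `a² + 3a + 3` up to sign.
  have e : ((a ^ 2 + 3 * a + 3 : ℤ) : ℝ) * σ (quadElt g x y z) =
      (((a ^ 2 + 3 * a + 3) * x - (a + 1) * y : ℤ) : ℝ) +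
      (((a ^ 2 + 3 * a + 3) * z + (a + 2) * y : ℤ) : ℝ) * t ^ 2 +
      ((-y : ℤ) : ℝ) * (t / (t + 1)) ^ 2 := by
    have hr := h.root_map σ
    have e1 : (t / (t + 1)) ^ 2 = -(a + 1) - (a ^ 2 + 3 * a + 3) * t + (a + 2) * t ^ 2 := by
      rw [div_pow, div_eq_iff (pow_ne_zero 2 ht1)]
      linear_combination (-(a + 2) * t - (a + 1)) * hr
    rw [e1]
    simp only [quadElt, map_add, map_mul, map_pow, map_intCast, ← ht]
    push_cast
    ring
  have hD' : (0 : ℝ) < ((a ^ 2 + 3 * a + 3 : ℤ) : ℝ) := by exact_mod_cast hD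
  refine pos_of_mul_pos_right (a := ((a ^ 2 + 3 * a + 3 : ℤ) : ℝ)) ?_ hD'.le
  rw [e]
  have p1 : (0 : ℝ) ≤ (((a ^ 2 + 3 * a + 3) * x - (a + 1) * y : ℤ) : ℝ) := by
    exact_mod_cast (by linarith : 0 ≤ (a ^ 2 + 3 * a + 3) * x - (a + 1) * y)
  have p2 : (0 : ℝ) ≤ (((a ^ 2 + 3 * a + 3) * z + (a + 2) * y : ℤ) : ℝ) := by
    exact_mod_cast (by linarith : 0 ≤ (a ^ 2 + 3 * a + 3) * z + (a + 2) * y)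
  rcases hy.lt_or_eq with hy | rfl
  · have p3 : (0 : ℝ) < ((-y : ℤ) : ℝ) := by exact_mod_cast (by omega : 0 < -y)
    positivity
  · simp only [mul_zero, sub_zero, add_zero, neg_zero, Int.cast_zero, zero_mul] at p1 p2 hx hz ⊢
    have hx0 : 0 ≤ x := nonneg_of_mul_nonneg_right hx hD
    have hz0 : 0 ≤ z := nonneg_of_mul_nonneg_right hz hD
    rcases hx0.lt_or_eq with hx1 | hx1
    · have : (0 : ℝ) < (((a ^ 2 + 3 * a + 3) * x : ℤ) : ℝ) := by exact_mod_cast mul_pos hD hx1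
      positivity
    · have hz1 : 0 < z := by omega
      have : (0 : ℝ) < (((a ^ 2 + 3 * a + 3) * z : ℤ) : ℝ) := by exact_mod_cast mul_pos hD hz1
      positivity

theorem not_isIndec_of_totallyPos {x y z : ℤ} (x₁ y₁ z₁ : ℤ)
    (h1 : TotallyPos (quadElt g x₁ y₁ z₁))
    (h2 : TotallyPos (quadElt g (x - x₁) (y - y₁) (z - z₁))) :
    ¬ IsIndec g (quadElt g x y z) := by
  intro hi
  have e : quadElt g x y z = quadElt g x₁ y₁ z₁ + quadElt g (x - x₁) (y - y₁) (z - z₁) := by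
    simp only [quadElt]; push_cast; ring
  have hs : signature (quadElt g x y z) = signature (1 : K) := by
    rw [← totallyPos_iff_signature, e]
    exact h1.add h2
  refine hi.2 ⟨_, _, ⟨quadElt_mem x₁ y₁ z₁, ?_⟩, ⟨quadElt_mem _ _ _, ?_⟩, e⟩
  · rw [hs, totallyPos_iff_signature.mp h1]
  · rw [hs, totallyPos_iff_signature.mp h2]

/-- Indecomposables in the cone spanned by `1`, `g²`, `(1 + g)²`, after descent. -/
theorem isRepresented_of_pos (h : SimplestCubic a g τ) {x y z : ℤ}
    (ih : ∀ x' y' z' : ℤ, x' + z' < x + z → TotallyPos (quadElt g x' y' z') →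
      IsIndec g (quadElt g x' y' z') → IsRepresented a g τ (quadElt g x' y' z'))
    (hp : TotallyPos (quadElt g x y z)) (hi : IsIndec g (quadElt g x y z)) (hy : 0 < y) :
    IsRepresented a g τ (quadElt g x y z) := by
  -- Applying `α ↦ g² τ(α)` once or twice changes the height to `x - y + 2z` or `2x - y + z`,
  -- smaller exactly when `z < y` or `x < y`.
  by_cases hz : z < y
  · exact h.isRepresented_of_sq_mul_map
      (ih _ _ _ (by omega) (h.totallyPos_sq_mul_map hp) (h.isIndec_sq_mul_map hi))
  by_cases hx : x < y
  · exact h.isRepresented_of_sq_mul_map (h.isRepresented_of_sq_mul_map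
      (ih _ _ _ (by omega) (h.totallyPos_sq_mul_map (h.totallyPos_sq_mul_map hp))
        (h.isIndec_sq_mul_map (h.isIndec_sq_mul_map hi))))
  -- Now `α = y (1 + g + g²) + (x - y) + (z - y) g²` with nonnegative coefficients, so `1 + g + g²`
  -- can be split off.
  by_cases h1 : x = 1 ∧ z = 1
  · obtain ⟨rfl, rfl⟩ := h1
    obtain rfl : y = 1 := by omega
    exact h.isRepresented_quadElt_one_one_one
  · refine absurd hi (not_isIndec_of_totallyPos 1 1 1 totallyPos_quadElt_one_one_one ?_)
    intro σ
    have ht0 : σ g ≠ 0 := by simpa using h.gen_ne_zero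
    have e : σ (quadElt g (x - 1) (y - 1) (z - 1)) =
        ((y - 1 : ℤ) : ℝ) * ((σ g + 1 / 2) ^ 2 + 3 / 4) + ((x - y : ℤ) : ℝ) +
          ((z - y : ℤ) : ℝ) * σ g ^ 2 := by
      simp only [quadElt, map_add, map_mul, map_pow, map_intCast]
      push_cast; ring
    rw [e]
    have p1 : (0 : ℝ) ≤ ((y - 1 : ℤ) : ℝ) := by exact_mod_cast (by omega : 0 ≤ y - 1)
    have p2 : (0 : ℝ) ≤ ((x - y : ℤ) : ℝ) := by exact_mod_cast (by omega : 0 ≤ x - y)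
    have p3 : (0 : ℝ) ≤ ((z - y : ℤ) : ℝ) := by exact_mod_cast (by omega : 0 ≤ z - y)
    rcases (by omega : 0 < y - 1 ∨ 0 < x - y ∨ 0 < z - y) with h2 | h2 | h2
    · have : (0 : ℝ) < ((y - 1 : ℤ) : ℝ) := by exact_mod_cast h2
      positivity
    · have : (0 : ℝ) < ((x - y : ℤ) : ℝ) := by exact_mod_cast h2
      positivity
    · have : (0 : ℝ) < ((z - y : ℤ) : ℝ) := by exact_mod_cast h2
      positivity

/-- Indecomposables in the cone spanned by `1`, `g²`, `g² / (1 + g)²` with positive first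
coordinate. -/
theorem isRepresented_of_one_le (h : SimplestCubic a g τ) {x y z : ℤ}
    (hi : IsIndec g (quadElt g x y z)) (hx : 1 ≤ x) (hy : y ≤ 0)
    (hz : -(a + 2) * y ≤ (a ^ 2 + 3 * a + 3) * z) :
    IsRepresented a g τ (quadElt g x y z) := by
  have ha := h.le
  have e1 : quadElt g 1 0 0 = (1 : K) := by simp [quadElt]
  by_cases h0 : x - 1 = 0 ∧ y - 0 = 0 ∧ z - 0 = 0
  · obtain ⟨h1, h2, h3⟩ := h0
    obtain rfl : x = 1 := by omega
    obtain rfl : y = 0 := by omega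
    obtain rfl : z = 0 := by omega
    rw [e1]
    exact h.isRepresented_of_isAdjoinUnit isAdjoinUnit_one
  · refine absurd hi (not_isIndec_of_totallyPos 1 0 0 ?_ ?_)
    · rw [e1]; exact totallyPos_one
    · refine h.totallyPos_of_mem_cone (by omega) ?_ (by simpa using hz) h0
      have : 0 ≤ (a ^ 2 + 3 * a + 3) * (x - 1) := mul_nonneg (by positivity) (by omega)
      nlinarith

/-- A criterion for total positivity in barycentric coordinates. -/
theorem totallyPos_of_barycentric (h : SimplestCubic a g τ) {x y z : ℤ} (h1 : 0 ≤ (a + 1) * z + y)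
    (h2 : x ≤ 0) (h3 : 0 ≤ (a + 1) * x - y - z) (hf : 1 ≤ x + z) :
    TotallyPos (quadElt g x y z) := by
  have ha := h.le
  have hN : 0 ≤ a + 1 := by omega
  have ha0 : 0 < a := by omega
  have k1 := mul_nonneg hN h1
  have k2 := mul_nonneg hN k1
  have k3 := mul_nonneg hN h3
  have k4 := mul_nonneg hN k3
  have k5 := mul_nonneg hN (neg_nonneg.mpr h2)
  have k6 := mul_nonneg hN k5
  -- With `N = a + 1`, `s₁ = N z + y`, `s₂ = -x`, `s₃ = N x - y - z`, the cone coordinates times `a`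
  -- are `s₁ + N² s₂ + N s₃`, `N s₁ + s₂ + N² s₃` and `N² s₁ + N s₂ + s₃`.
  refine h.totallyPos_of_mem_cone ?_ ?_ ?_ (by omega)
  · have : 0 ≤ a * (-y) := by nlinarith
    have := nonneg_of_mul_nonneg_right this ha0
    omega
  · have : 0 ≤ a * ((a ^ 2 + 3 * a + 3) * x - (a + 1) * y) := by nlinarith
    have := nonneg_of_mul_nonneg_right this ha0
    omega
  · have : 0 ≤ a * ((a ^ 2 + 3 * a + 3) * z + (a + 2) * y) := by nlinarith
    have := nonneg_of_mul_nonneg_right this ha0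
    linarith

/-- The points of the triangle with barycentric coordinates `s₁ + s₂ + s₃ = a`, in one half. -/
theorem isRepresented_barycentric (h : SimplestCubic a g τ) {s₁ s₂ s₃ : ℤ} (h1 : 0 ≤ s₁)
    (h2 : 0 ≤ s₂) (hs : s₁ + s₂ + s₃ = a) (h23 : s₂ ≤ s₃) (h3a : s₃ < a) :
    IsRepresented a g τ (quadElt g (-s₂) (s₁ - (a + 1) * (1 + s₂)) (1 + s₂)) := by
  have hp : TotallyPos (quadElt g (-s₂) (s₁ - (a + 1) * (1 + s₂)) (1 + s₂)) :=
    h.totallyPos_of_barycentric (by linarith) (by omega) (by linarith) (by omega)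
  obtain ⟨j, rfl⟩ := Int.eq_ofNat_of_zero_le h2
  -- The point is the semiconvergent of state 2 with `j = s₂`, `i = s₃ - s₂ + 1`; the bounds `s₂ ≤
  -- s₃ < a` ensure `1 ≤ i ≤ a`.
  obtain ⟨i, hi⟩ := Int.eq_ofNat_of_zero_le (by omega : 0 ≤ s₃ - j + 1)
  have e : s₁ - (a + 1) * (1 + (j : ℤ)) = -i - (a + 3) * j := by
    rw [← hs] at *
    linarith
  rw [e] at hp ⊢
  exact h.isRepresented_triangle (by omega) (by omega) hp

end SimplestCubic

namespace SimplestCubic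

variable {K : IntermediateField ℚ ℝ} {a : ℤ} {g : K} {τ : K ≃ₐ[ℚ] K}

/-- Indecomposables with nonnegative barycentric coordinates. -/
theorem isRepresented_of_barycentric (h : SimplestCubic a g τ) {x y z : ℤ}
    (hi : IsIndec g (quadElt g x y z)) (h1 : 0 ≤ (a + 1) * z + y)
    (h2 : x ≤ 0) (h3 : 0 ≤ (a + 1) * x - y - z) (hf : 1 ≤ x + z) :
    IsRepresented a g τ (quadElt g x y z) := by
  have ha := h.le
  obtain ⟨f, rfl⟩ : ∃ f, z = f - x := ⟨x + z, by ring⟩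
  obtain ⟨s₁, hs₁⟩ : ∃ s₁, s₁ = (a + 1) * (f - x) + y := ⟨_, rfl⟩
  obtain ⟨s₂, hs₂⟩ : ∃ s₂, s₂ = -x := ⟨_, rfl⟩
  obtain ⟨s₃, hs₃⟩ : ∃ s₃, s₃ = (a + 1) * x - y - (f - x) := ⟨_, rfl⟩
  have hsum : s₁ + s₂ + s₃ = a * f := by rw [hs₁, hs₂, hs₃]; ring
  rw [← hs₁] at h1
  rw [← hs₃] at h3
  rcases (by omega : f = 1 ∨ 2 ≤ f) with rfl | hf2
  · rw [mul_one] at hsum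
    obtain rfl : x = -s₂ := by omega
    have hy : y = s₁ - (a + 1) * (1 + s₂) := by rw [hs₁]; ring
    subst hy
    -- `α ↦ g² τ²(α)` rotates the coordinates `(t₁, t₂, t₃)` to `(t₃, t₁, t₂)`. Some rotation
    -- satisfies `s₂ ≤ s₃ < a`, corners included.
    have e : ∀ t₁ t₂ t₃ : ℤ, t₁ + t₂ + t₃ = a →
        quadElt g (-((a + 1) * (1 + t₂) + (t₁ - (a + 1) * (1 + t₂))))
          (-(a + 2) * (t₁ - (a + 1) * (1 + t₂)) - (a ^ 2 + 3 * a + 3) * (1 + t₂))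
          (-t₂ + (a + 2) * (1 + t₂) + (t₁ - (a + 1) * (1 + t₂))) =
        quadElt g (-t₁) (t₃ - (a + 1) * (1 + t₁)) (1 + t₁) := by
      rintro t₁ t₂ t₃ rfl
      congr 1 <;> ring
    have e0 : (1 : ℤ) - -s₂ = 1 + s₂ := by ring
    rw [e0] at *
    by_cases c1 : s₂ ≤ s₃ ∧ s₃ < a
    · exact h.isRepresented_barycentric h1 (by omega) hsum c1.1 c1.2
    by_cases c2 : s₁ ≤ s₂ ∧ s₂ < a
    · apply h.isRepresented_of_sq_mul_map_map
      rw [e s₁ s₂ s₃ hsum]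
      exact h.isRepresented_barycentric (s₃ := s₂) h3 h1 (by omega) c2.1 c2.2
    · apply h.isRepresented_of_sq_mul_map_map
      rw [e s₁ s₂ s₃ hsum]
      apply h.isRepresented_of_sq_mul_map_map
      rw [e s₃ s₁ s₂ (by omega)]
      exact h.isRepresented_barycentric (s₃ := s₁) (by omega) h3 (by omega) (by omega) (by omega)
  · have hge : 2 * a ≤ s₁ + s₂ + s₃ := by rw [hsum]; nlinarith
    -- A greedy choice of a height 1 point below `s`; the difference has nonnegative coordinates and
    -- height `f - 1 ≥ 1`.
    obtain ⟨b₁, b₂, b₃, hb, hb1, hb2, hb3, hb1', hb2', hb3'⟩ : ∃ b₁ b₂ b₃ : ℤ, b₁ + b₂ + b₃ = a ∧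
        0 ≤ b₁ ∧ 0 ≤ b₂ ∧ 0 ≤ b₃ ∧ b₁ ≤ s₁ ∧ b₂ ≤ s₂ ∧ b₃ ≤ s₃ :=
      ⟨min s₁ a, min s₂ (a - min s₁ a), a - min s₁ a - min s₂ (a - min s₁ a),
        by omega, by omega, by omega, by omega, by omega, by omega, by omega⟩
    refine absurd hi (not_isIndec_of_totallyPos (-b₂) (b₁ - (a + 1) * (1 + b₂)) (1 + b₂) ?_ ?_)
    · exact h.totallyPos_of_barycentric (by linarith) (by omega) (by linarith) (by omega)
    · exact h.totallyPos_of_barycentric (by linarith) (by omega) (by linarith) (by omega)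

/-- Every totally positive indecomposable is represented by a semiconvergent. -/
theorem isRepresented_of_totallyPos (h : SimplestCubic a g τ) (n : ℕ) : ∀ {x y z : ℤ},
    x + z ≤ n → TotallyPos (quadElt g x y z) → IsIndec g (quadElt g x y z) →
      IsRepresented a g τ (quadElt g x y z) := by
  induction n with
  | zero =>
    intro x y z hn hp
    have := h.one_le_add_of_totallyPos hp
    omega
  | succ n ih =>
    intro x y z hn hp hi
    have hf := h.one_le_add_of_totallyPos hp
    have ha := h.le
    by_cases hy : 0 < y
    · exact h.isRepresented_of_pos (fun x' y' z' h' => ih (by omega)) hp hi hy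
    have hp1 := h.totallyPos_sq_mul_map_map hp
    have hi1 := h.isIndec_sq_mul_map_map hi
    have hr1 := h.isRepresented_of_sq_mul_map_map (x := x) (y := y) (z := z)
    obtain ⟨x₁, hx₁⟩ : ∃ t, t = -((a + 1) * z + y) := ⟨_, rfl⟩
    obtain ⟨y₁, hy₁⟩ : ∃ t, t = -(a + 2) * y - (a ^ 2 + 3 * a + 3) * z := ⟨_, rfl⟩
    obtain ⟨z₁, hz₁⟩ : ∃ t, t = x + (a + 2) * z + y := ⟨_, rfl⟩
    have hf1 : x₁ + z₁ = x + z := by rw [hx₁, hz₁]; ring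
    rw [← hx₁, ← hy₁, ← hz₁] at hp1 hi1 hr1
    by_cases hy1 : 0 < y₁
    · exact hr1 (h.isRepresented_of_pos (fun x' y' z' h' => ih (by omega)) hp1 hi1 hy1)
    have hp2 := h.totallyPos_sq_mul_map_map hp1
    have hi2 := h.isIndec_sq_mul_map_map hi1
    have hr2 := h.isRepresented_of_sq_mul_map_map (x := x₁) (y := y₁) (z := z₁)
    obtain ⟨x₂, hx₂⟩ : ∃ t, t = -((a + 1) * z₁ + y₁) := ⟨_, rfl⟩
    obtain ⟨y₂, hy₂⟩ : ∃ t, t = -(a + 2) * y₁ - (a ^ 2 + 3 * a + 3) * z₁ := ⟨_, rfl⟩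
    obtain ⟨z₂, hz₂⟩ : ∃ t, t = x₁ + (a + 2) * z₁ + y₁ := ⟨_, rfl⟩
    have hf2 : x₂ + z₂ = x₁ + z₁ := by rw [hx₂, hz₂]; ring
    rw [← hx₂, ← hy₂, ← hz₂] at hp2 hi2 hr2
    by_cases hy2 : 0 < y₂
    · exact hr1 (hr2 (h.isRepresented_of_pos (fun x' y' z' h' => ih (by omega)) hp2 hi2 hy2))
    -- `y`, `y₁`, `y₂` are minus the cone coordinates up to the factor `a² + 3a + 3`, and `-x₁`,
    -- `-x`, `-x₂` are the barycentric ones. A positive `x`, `x₁` or `x₂` lets a unit split off.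
    have hx₂' : x₂ = -((a + 1) * x - y - z) := by rw [hx₂, hz₁, hy₁]; ring
    have hy₃ : y = -(a + 2) * y₂ - (a ^ 2 + 3 * a + 3) * z₂ := by
      rw [hy₂, hz₂, hx₁, hz₁, hy₁]; ring
    by_cases c0 : 1 ≤ x
    · exact h.isRepresented_of_one_le hi c0 (by omega) (by linarith)
    by_cases c1 : 1 ≤ x₁
    · exact hr1 (h.isRepresented_of_one_le hi1 c1 (by omega) (by linarith))
    by_cases c2 : 1 ≤ x₂
    · exact hr1 (hr2 (h.isRepresented_of_one_le hi2 c2 (by omega) (by linarith)))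
    · exact h.isRepresented_of_barycentric hi (by omega) (by omega) (by omega) hf

/-- Total positivity of an element of `ℤ[g]` can be checked on its three conjugates. -/
theorem totallyPos_of_conjugates (h : SimplestCubic a g τ) {x : K}
    (hx : x ∈ Algebra.adjoin ℤ {g}) (h1 : (0 : ℝ) < x) (h2 : (0 : ℝ) < (τ x : K))
    (h3 : (0 : ℝ) < (τ (τ x) : K)) : TotallyPos x := by
  intro σ
  have h0 := h.gen_pos
  obtain ⟨p, q, r, rfl⟩ := h.mem_adjoin_iff.mp hx
  rw [coe_quadElt] at h1
  rw [h.coe_map_quadElt] at h2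
  rw [h.coe_map_map_quadElt] at h3
  have e : (σ g - (g : ℝ)) * ((g : ℝ) * σ g + ((g : ℝ) + 1)) * (((g : ℝ) + 1) * σ g + 1) = 0 := by
    linear_combination ((g : ℝ) * ((g : ℝ) + 1)) * h.root_map σ -
      (σ g * (σ g + 1)) * h.root_real
  have e1 : σ (quadElt g p q r) = p + q * σ g + r * σ g ^ 2 := by simp [quadElt]
  rw [e1]
  rcases mul_eq_zero.mp e with e2 | e2
  · rcases mul_eq_zero.mp e2 with e3 | e3
    · rwa [sub_eq_zero.mp e3]
    · have : σ g = -((g : ℝ) + 1) / g := by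
        rw [eq_div_iff h0.ne']; linear_combination e3
      rwa [this]
  · have : σ g = -1 / ((g : ℝ) + 1) := by
      rw [eq_div_iff (by positivity)]; linear_combination e2
    rwa [this]

/-- Every nonzero element of `ℤ[g]` can be made totally positive by a unit. -/
theorem exists_isAdjoinUnit_totallyPos (h : SimplestCubic a g τ) {x : K}
    (hx : x ∈ Algebra.adjoin ℤ {g}) (hx0 : x ≠ 0) :
    ∃ u, IsAdjoinUnit g u ∧ TotallyPos (u * x) := by
  have hg := h.isAdjoinUnit_gen
  have hg1 := h.isAdjoinUnit_gen_add_one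
  have g0 := h.gen_pos
  have b0 := h.coe_map_map_gen_bounds
  have b1 : ((τ g : K) : ℝ) < -1 := by
    rw [h.coe_map_gen, div_lt_iff₀ g0]; linarith
  wlog hA : (0 : ℝ) < x generalizing x with H
  · have : (x : ℝ) ≠ 0 := by exact_mod_cast hx0
    obtain ⟨u, hu, hp⟩ := H (neg_mem hx) (neg_ne_zero.mpr hx0) (by
      push_cast
      have := lt_of_le_of_ne (not_lt.mp hA) this
      linarith)
    exact ⟨u * -1, hu.mul isAdjoinUnit_neg_one, by rwa [mul_assoc, neg_one_mul]⟩
  have hB : ((τ x : K) : ℝ) ≠ 0 := by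
    have := (map_ne_zero τ).mpr hx0
    exact_mod_cast this
  have hC : ((τ (τ x) : K) : ℝ) ≠ 0 := by
    have := (map_ne_zero τ).mpr ((map_ne_zero τ).mpr hx0)
    exact_mod_cast this
  have key : ∀ u : K, IsAdjoinUnit g u → (0 : ℝ) < u → (0 : ℝ) < (τ u : K) * (τ x : K) →
      (0 : ℝ) < (τ (τ u) : K) * (τ (τ x) : K) → ∃ u, IsAdjoinUnit g u ∧ TotallyPos (u * x) := by
    intro u hu k1 k2 k3
    refine ⟨u, hu, h.totallyPos_of_conjugates (mul_mem hu.mem hx) ?_ ?_ ?_⟩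
    · push_cast; exact mul_pos k1 hA
    · rw [map_mul]; push_cast; exact k2
    · rw [map_mul, map_mul]; push_cast; exact k3
  -- At the embeddings through `1`, `τ`, `τ²` the signs are `(+,-,-)` for `g`, `(+,-,+)` for `g + 1`
  -- and `(+,+,-)` for `g (g + 1)`.
  rcases hB.lt_or_gt with hB | hB <;> rcases hC.lt_or_gt with hC | hC
  · exact key g hg g0 (mul_pos_of_neg_of_neg (by linarith) hB)
      (mul_pos_of_neg_of_neg (by linarith) hC)
  · refine key (g + 1) hg1 (by push_cast; linarith) ?_ ?_
    · rw [map_add, map_one]; push_cast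
      exact mul_pos_of_neg_of_neg (by linarith) hB
    · rw [map_add, map_add, map_one, map_one]; push_cast
      exact mul_pos (by linarith) hC
  · refine key (g * (g + 1)) (hg.mul hg1) (by push_cast; positivity) ?_ ?_
    · rw [map_mul, map_add, map_one]; push_cast
      exact mul_pos (mul_pos_of_neg_of_neg (by linarith) (by linarith)) hB
    · rw [map_mul, map_mul, map_add, map_add, map_one, map_one]; push_cast
      exact mul_pos_of_neg_of_neg (mul_neg_of_neg_of_pos (by linarith) (by linarith)) hC
  · exact key 1 isAdjoinUnit_one (by simp) (by simpa using hB) (by simpa using hC)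

/-- Every indecomposable is represented by a semiconvergent. -/
theorem isRepresented_of_isIndecomposableOfSign (h : SimplestCubic a g τ)
    {s : (K →+* ℝ) → SignType} {α : K}
    (hα : IsIndecomposableOfSign (Algebra.adjoin ℤ {g}) s α) : IsRepresented a g τ α := by
  obtain ⟨hmem, rfl⟩ := hα.1
  have h0 : α ≠ 0 := by
    rintro rfl
    exact hα.2 ⟨0, 0, ⟨hmem, rfl⟩, ⟨hmem, rfl⟩, by simp⟩
  obtain ⟨u, hu, hp⟩ := h.exists_isAdjoinUnit_totallyPos hmem h0
  have hi : IsIndec g (u * α) := IsIndec.unit_mul hu hα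
  refine IsRepresented.of_unit_mul hu ?_
  obtain ⟨x, y, z, e⟩ := h.mem_adjoin_iff.mp (mul_mem hu.mem hmem)
  rw [e] at hp hi ⊢
  exact h.isRepresented_of_totallyPos (x + z).toNat (Int.self_le_toNat _) hp hi

/-- States 0, 3 and 6 have both quotients below 2 and contribute nothing. -/
theorem isIndec_of_state (h : SimplestCubic a g τ) {s : ℕ} (hs : s ≤ 8) {x : K}
    (hx : IsGeneralizedSemiconvergent (jpaState a g s 0) (jpaState a g s 1) (jpaState a g s 2) x ∨
      IsGeneralizedSemiconvergent (jpaState a g s 0) (jpaState a g s 2) (jpaState a g s 1) x) :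
    IsIndec g x := by
  have h0 := h.gen_pos
  have h1 := h.lt
  have h2 := h.le_real
  have h3 := h.lt_add_two
  have h4 := h.sq_sub_eq_real
  have h5 := h.one_div_bounds
  have h6 := h.sq_sub_sub_eq_real (a / 2 : ℤ)
  have h7 := two_mul_half_le a
  have h8 := le_two_mul_half a
  have h9 := h.seven_le_half
  have h10 := h.sq_eq_real (a / 2 : ℤ)
  interval_cases s
  · refine absurd hx (not_or.mpr ⟨?_, ?_⟩)
    · refine not_isGeneralizedSemiconvergent (b := g ^ 2) (p := g ^ 2 + g) ?_ ?_ <;>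
        push_cast <;> nlinarith
    · refine not_isGeneralizedSemiconvergent (b := g ^ 2) (p := (g + 1) ^ 2) ?_ ?_ <;>
        push_cast <;> nlinarith
  · exact hx.elim h.isIndec_state_one_two h.isIndec_state_one_three
  · refine hx.elim (fun hx => absurd hx ?_) h.isIndec_state_two_three
    refine not_isGeneralizedSemiconvergent (b := 1) (p := g ^ 2 - ((a : K) + 1) * g) ?_ ?_ <;>
      push_cast <;> linarith
  · refine absurd hx (not_or.mpr ⟨?_, ?_⟩)
    · refine not_isGeneralizedSemiconvergent (b := g ^ 2 - ((a : K) + 1) * g - 1)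
        (p := g - ((a : K) + 1)) ?_ ?_ <;> push_cast <;> linarith
    · refine not_isGeneralizedSemiconvergent (b := g ^ 2 - ((a : K) + 1) * g - 1)
        (p := 1) ?_ ?_ <;> push_cast <;> linarith
  · refine hx.elim (fun hx => absurd hx ?_) h.isIndec_state_four_three
    refine not_isGeneralizedSemiconvergent (b := 2 * g + 1) (p := g) ?_ ?_ <;>
      push_cast [coe_two] <;> linarith
  · refine hx.elim (fun hx => absurd hx ?_) h.isIndec_state_five_three
    refine not_isGeneralizedSemiconvergent (b := g)
      (p := g ^ 2 - ((a / 2 : ℤ) : K) * (2 * g + 1)) ?_ ?_ <;>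
      push_cast [coe_two] <;> nlinarith
  · refine absurd hx (not_or.mpr ⟨?_, ?_⟩)
    · refine not_isGeneralizedSemiconvergent (b := g ^ 2 - (a : K) * g - ((a / 2 : ℤ) : K))
        (p := 1) ?_ ?_ <;> push_cast <;> linarith
    · refine not_isGeneralizedSemiconvergent (b := g ^ 2 - (a : K) * g - ((a / 2 : ℤ) : K))
        (p := g) ?_ ?_ <;> push_cast <;> linarith
  · exact hx.elim h.isIndec_state_seven_two h.isIndec_state_seven_three
  · refine hx.elim (fun hx => absurd hx ?_) h.isIndec_state_eight_three
    refine not_isGeneralizedSemiconvergent (b := g) (p := g + 1) ?_ ?_ <;>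
      push_cast <;> linarith

theorem isIndec_of_expansion (h : SimplestCubic a g τ) {r : K} (hr : g * r = -(g + 1)) (k : ℕ)
    {x : K} (hx : IsGeneralizedSemiconvergent (jpaExpansion ![1, -r, r ^ 2] k 0)
        (jpaExpansion ![1, -r, r ^ 2] k 1) (jpaExpansion ![1, -r, r ^ 2] k 2) x ∨
      IsGeneralizedSemiconvergent (jpaExpansion ![1, -r, r ^ 2] k 0)
        (jpaExpansion ![1, -r, r ^ 2] k 2) (jpaExpansion ![1, -r, r ^ 2] k 1) x) :
    IsIndec g x := by
  obtain ⟨s, hs, c, hc, e⟩ := h.exists_atState_jpaExpansion hr k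
  rw [e] at hx
  have hc0 := hc.ne_zero
  rw [← isIndec_unit_mul_iff hc.inv]
  refine h.isIndec_of_state hs (hx.imp (fun hx => ?_) (fun hx => ?_))
  · simpa only [inv_mul_cancel_left₀ hc0] using
      isGeneralizedSemiconvergent_mul (inv_ne_zero hc0) hx
  · simpa only [inv_mul_cancel_left₀ hc0] using
      isGeneralizedSemiconvergent_mul (inv_ne_zero hc0) hx

theorem exists_expansion_of_isRepresented (h : SimplestCubic a g τ) {r : K}
    (hr : g * r = -(g + 1)) {α : K} (hα : IsRepresented a g τ α) :
    ∃ (k : ℕ) (x : K) (ε : (Algebra.adjoin ℤ {g})ˣ) (σ : K ≃ₐ[ℚ] K),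
      (IsGeneralizedSemiconvergent (jpaExpansion ![1, -r, r ^ 2] k 0)
        (jpaExpansion ![1, -r, r ^ 2] k 1) (jpaExpansion ![1, -r, r ^ 2] k 2) x ∨
      IsGeneralizedSemiconvergent (jpaExpansion ![1, -r, r ^ 2] k 0)
        (jpaExpansion ![1, -r, r ^ 2] k 2) (jpaExpansion ![1, -r, r ^ 2] k 1) x) ∧
      α = ((ε : Algebra.adjoin ℤ {g}) : K) * σ x := by
  obtain ⟨s, hs, x, u, n, hx, hu, rfl⟩ := hα
  obtain ⟨c, hc, e⟩ := h.atState_jpaExpansion hr hs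
  obtain ⟨ε, hε⟩ := hu.mul (h.isAdjoinUnit_pow_map hc n).inv
  -- The scaling unit `c` is absorbed through `u τⁿ(x) = (u / τⁿ(c)) τⁿ(c x)`.
  refine ⟨s, c * x, ε, τ ^ n, ?_, ?_⟩
  · rw [e]
    exact hx.imp (isGeneralizedSemiconvergent_mul hc.ne_zero)
      (isGeneralizedSemiconvergent_mul hc.ne_zero)
  · rw [hε, map_mul, mul_assoc, inv_mul_cancel_left₀ (h.isAdjoinUnit_pow_map hc n).ne_zero]

end SimplestCubic

/-! ### Irreducibility, and existence of `τ`. -/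

open Polynomial in
/-- The polynomial of the simplest cubic fields. -/
noncomputable def simplestCubicPoly (a : ℤ) : ℤ[X] := X ^ 3 - C a * X ^ 2 - C (a + 3) * X - 1

open Polynomial in
theorem simplestCubicPoly_monic (a : ℤ) : (simplestCubicPoly a).Monic := by
  unfold simplestCubicPoly; monicity!

-- A rational root of this monic cubic would be an integer dividing 1, and `1`, `-1` are not roots.
open Polynomial in
theorem simplestCubicPoly_map_irreducible {a : ℤ} (ha : 0 ≤ a) :
    Irreducible ((simplestCubicPoly a).map (Int.castRingHom ℚ)) := by
  have hdeg : ((simplestCubicPoly a).map (Int.castRingHom ℚ)).natDegree = 3 := by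
    rw [(simplestCubicPoly_monic a).natDegree_map]
    unfold simplestCubicPoly; compute_degree!
  apply Polynomial.irreducible_of_degree_le_three_of_not_isRoot
  · rw [hdeg]; simp
  · intro q hq
    have hq' : aeval q (simplestCubicPoly a) = 0 := by
      rwa [IsRoot.def, eval_map] at hq
    obtain ⟨t, rfl⟩ := isInteger_of_is_root_of_monic (simplestCubicPoly_monic a) hq'
    have ht : t * (t ^ 2 - a * t - (a + 3)) = 1 := by
      have : ((t : ℚ) * ((t : ℚ) ^ 2 - a * t - (a + 3))) = 1 := by
        simp [simplestCubicPoly, map_ofNat] at hq'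
        linear_combination hq'
      exact_mod_cast this
    rcases Int.isUnit_iff.mp (IsUnit.of_mul_eq_one _ ht) with rfl | rfl
    · omega
    · omega

open Polynomial in
/-- The automorphism of the simplest cubic field. -/
theorem exists_simplestCubic {a : ℤ} (ha : 15 ≤ a) {ρ : ℝ}
    (hρ : ρ ^ 3 - a * ρ ^ 2 - (a + 3) * ρ - 1 = 0) (hρ₁ : a + 1 < ρ) {r : ℚ⟮ρ⟯}
    (hr : r ^ 3 - a * r ^ 2 - (a + 3) * r - 1 = 0)
    (hgr : IntermediateField.AdjoinSimple.gen ℚ ρ * r =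
      -(IntermediateField.AdjoinSimple.gen ℚ ρ + 1)) :
    ∃ τ : ℚ⟮ρ⟯ ≃ₐ[ℚ] ℚ⟮ρ⟯, SimplestCubic a (IntermediateField.AdjoinSimple.gen ℚ ρ) τ := by
  set f := (simplestCubicPoly a).map (Int.castRingHom ℚ) with hf
  have hmon : f.Monic := (simplestCubicPoly_monic a).map _
  have hroot : aeval ρ f = 0 := by
    rw [hf]
    simp [simplestCubicPoly, map_ofNat]
    linear_combination hρ
  have hint : IsIntegral ℚ ρ := ⟨f, hmon, hroot⟩
  have hmin : minpoly ℚ ρ = f :=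
    (minpoly.eq_of_irreducible_of_monic (simplestCubicPoly_map_irreducible (by omega)) hroot
      hmon).symm
  have hr0 : r ∈ (minpoly ℚ ρ).aroots ℚ⟮ρ⟯ := by
    rw [mem_aroots, hmin]
    refine ⟨hmon.ne_zero, ?_⟩
    rw [hf]
    simp [simplestCubicPoly, map_ofNat]
    linear_combination hr
  let φ : ℚ⟮ρ⟯ →ₐ[ℚ] ℚ⟮ρ⟯ := (IntermediateField.algHomAdjoinIntegralEquiv ℚ hint).symm ⟨r, hr0⟩
  have hφ : φ (IntermediateField.AdjoinSimple.gen ℚ ρ) = r :=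
    IntermediateField.algHomAdjoinIntegralEquiv_symm_apply_gen ℚ hint ⟨r, hr0⟩
  have : FiniteDimensional ℚ ℚ⟮ρ⟯ := IntermediateField.adjoin.finiteDimensional hint
  refine ⟨AlgEquiv.ofBijective φ (Algebra.IsAlgebraic.algHom_bijective φ), ha, ?_, hρ₁, ?_⟩
  · apply Subtype.ext
    push_cast
    rw [IntermediateField.AdjoinSimple.coe_gen]
    have : ((3 : ℚ⟮ρ⟯) : ℝ) = 3 := rfl
    rw [this]
    linear_combination hρ
  · rw [AlgEquiv.ofBijective_apply, hφ, hgr]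

theorem mainTheorem8 (a : ℤ) (ha : 15 ≤ a) (ρ ρ' : ℝ)
    (hρ : ρ ^ 3 - a * ρ ^ 2 - (a + 3) * ρ - 1 = 0) (hρ₁ : a + 1 < ρ)
    (hρ' : ρ' ^ 3 - a * ρ' ^ 2 - (a + 3) * ρ' - 1 = 0) (h₂ : -2 < ρ') (h₁ : ρ' < -1) :
    -- the order `ℤ[ρ]`, the conjugate `ρ'` and the expansion of `(1, -ρ', ρ'²)` in `ℚ(ρ)`
    let O : Subalgebra ℤ ℚ⟮ρ⟯ := Algebra.adjoin ℤ {IntermediateField.AdjoinSimple.gen ℚ ρ}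
    let r : ℚ⟮ρ⟯ := ⟨ρ', root_mem_adjoin (by omega) hρ hρ₁ hρ' h₁⟩
    let β : ℕ → Fin 3 → ℚ⟮ρ⟯ := jpaExpansion ![1, -r, r ^ 2]
    (∀ (k : ℕ) (x : ℚ⟮ρ⟯), IsGeneralizedSemiconvergent (β k 0) (β k 1) (β k 2) x →
      IsIndecomposableOfSign O (signature x) x) ∧
    (∀ (k : ℕ) (x : ℚ⟮ρ⟯), IsGeneralizedSemiconvergent (β k 0) (β k 2) (β k 1) x →
      IsIndecomposableOfSign O (signature x) x) ∧
    (∀ (s : (ℚ⟮ρ⟯ →+* ℝ) → SignType) (α : ℚ⟮ρ⟯), IsIndecomposableOfSign O s α →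
      ∃ (k : ℕ) (x : ℚ⟮ρ⟯) (ε : Oˣ) (σ : ℚ⟮ρ⟯ ≃ₐ[ℚ] ℚ⟮ρ⟯),
        (IsGeneralizedSemiconvergent (β k 0) (β k 1) (β k 2) x ∨
          IsGeneralizedSemiconvergent (β k 0) (β k 2) (β k 1) x) ∧
        α = ((ε : O) : ℚ⟮ρ⟯) * σ x) := by

  intro O r β
  have hgr : IntermediateField.AdjoinSimple.gen ℚ ρ * r =
      -(IntermediateField.AdjoinSimple.gen ℚ ρ + 1) := by
    apply Subtype.ext
    push_cast
    rw [IntermediateField.AdjoinSimple.coe_gen]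
    change ρ * ρ' = -(ρ + 1)
    have ha' : (15 : ℝ) ≤ a := by exact_mod_cast ha
    -- The factors correspond to the roots `ρ`, `-(ρ + 1)/ρ` and `-1/(ρ + 1)`; only the second is
    -- less than `-1`.
    have hz : (ρ' - ρ) * (ρ * ρ' + ρ + 1) * ((1 + ρ) * ρ' + 1) = 0 := by
      linear_combination (ρ * (1 + ρ)) * hρ' - (ρ' * (1 + ρ')) * hρ
    have e1 : ρ' - ρ ≠ 0 := by
      intro h; linarith
    have e3 : (1 + ρ) * ρ' + 1 ≠ 0 := by
      intro h; nlinarith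
    rcases mul_eq_zero.mp hz with h | h
    · linear_combination (mul_eq_zero.mp h).resolve_left e1
    · exact absurd h e3
  have hr : r ^ 3 - a * r ^ 2 - (a + 3) * r - 1 = 0 := by
    apply Subtype.ext
    push_cast
    exact hρ'
  obtain ⟨τ, h⟩ := exists_simplestCubic ha hρ hρ₁ hr hgr
  exact ⟨fun k x hx => h.isIndec_of_expansion hgr k (Or.inl hx),
    fun k x hx => h.isIndec_of_expansion hgr k (Or.inr hx),
    fun s α hα => h.exists_expansion_of_isRepresented hgr
      (h.isRepresented_of_isIndecomposableOfSign hα)⟩
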